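/- Let $n\ge 1$, let $\mathbb{B}_n$ be the open unit ball of $\mathbb{C}^n$, and let $S_1,\dots,S_n$ be the left creation operators on the full Fock space over $\mathbb{C}^n$. Let $F_n^\infty$ be the closure, in the weak operator topology, of the algebra generated by $1,S_1,\dots,S_n$; its weak* topology is the weak operator topology. For $\lambda\in\mathbb{B}_n$ and $\varphi\in F_n^\infty$ write $\varphi(\lambda)=\pi_\lambda(\varphi)$, where $\pi_\lambda:F_n^\infty\to\mathbb{C}$ is the unique weak* continuous unital algebra homomorphism with $\pi_\lambda(S_j)=\lambda_j$ for all $j$. For $\Delta\subseteq\mathbb{B}_n$ let $\mathcal{N}_\Delta=\{\varphi\in F_n^\infty:\varphi(z)=0\ \text{for all}\ z\in\Delta\}$ be the Nevanlinna ideal of $\Delta$, and let $\overline{\Delta}^{\Sigma}=\{z\in\mathbb{B}_n:\varphi(z)=0\ \text{for all}\ \varphi\in\mathcal{N}_\Delta\}$ be the spectral closure of $\Delta$. The elements of $F_n^\infty/\mathcal{N}_\Delta$ can be evaluated at the points of $\overline{\Delta}^{\Sigma}$. Let $\operatorname{Aut}(F_n^\infty/\mathcal{N}_\Delta)$ be the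 group of completely isometric algebra automorphisms of $F_n^\infty/\mathcal{N}_\Delta$ that are weak* continuous together with their inverses, where $M_k(F_n^\infty/\mathcal{N}_\Delta)=M_k(F_n^\infty)/M_k(\mathcal{N}_\Delta)$ carries the quotient norm and $F_n^\infty/\mathcal{N}_\Delta$ carries the weak* topology that it has as the dual of the polar of $\mathcal{N}_\Delta$ in the predual of $F_n^\infty$. The dual map of $\Phi\in\operatorname{Aut}(F_n^\infty/\mathcal{N}_\Delta)$ is $$\widehat{\Phi}:\overline{\Delta}^{\Sigma}\to\mathbb{C}^n,\qquad \widehat{\Phi}(\lambda)=\bigl(\Phi^{-1}(S_1+\mathcal{N}_\Delta)(\lambda),\dots,\Phi^{-1}(S_n+\mathcal{N}_\Delta)(\lambda)\bigr).$$ The group $SU(n,1)$ of the complex $(n+1)\times(n+1)$ matrices of determinant $1$ that preserve the Hermitian form $|z_1|^2+\dots+|z_n|^2-|t|^2$ acts on $\mathbb{B}_n$ by fractional linear transformations: the image of $z$ under $M$ is the point $w$ for which $(w,1)$ is proportional to $M(z,1)$. Let $\Gamma$ be the group of those transformations $\gamma$ of $\mathbb{B}_n$ that are induced by elements of $SU(n,1)$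 and satisfy $\gamma(\overline{\Delta}^{\Sigma})=\overline{\Delta}^{\Sigma}$. **Theorem.** Suppose that $\overline{\Delta}^{\Sigma}$ affinely spans $\mathbb{C}^n$, i.e. it is not contained in a proper complex affine subspace of $\mathbb{C}^n$ (if $0\in\overline{\Delta}^{\Sigma}$, this says that the linear span of $\overline{\Delta}^{\Sigma}$ is $\mathbb{C}^n$). Then for each $\Phi\in\operatorname{Aut}(F_n^\infty/\mathcal{N}_\Delta)$ the dual map $\widehat{\Phi}$ extends to exactly one biholomorphic map $\overleftrightarrow{\Phi}$ of $\mathbb{B}_n$ onto itself, this map belongs to $\Gamma$, and $\Phi\mapsto\overleftrightarrow{\Phi}$ is a group isomorphism of $\operatorname{Aut}(F_n^\infty/\mathcal{N}_\Delta)$ onto $\Gamma$. -/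

import Mathlib

open scoped InnerProductSpace

noncomputable section

namespace NCHardy

/-! ### The unit ball -/

/-- `ℂⁿ` with its canonical Hermitian norm. -/
abbrev Cn (n : ℕ) : Type := EuclideanSpace ℂ (Fin n)

/-- The open unit ball of `ℂⁿ`. -/
abbrev Ball (n : ℕ) : Type := Metric.ball (0 : Cn n) 1

/-! ### The full Fock space and the left creation operators -/

/-- The full Fock space over `ℂⁿ`, realised as `ℓ²` of the words in the letters `0, …, n - 1`:
the word `[i₁, …, iₘ]` labels the orthonormal basis vector `e_{i₁} ⊗ ⋯ ⊗ e_{iₘ}`. -/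
abbrev Fock (n : ℕ) : Type := lp (fun _ : List (Fin n) => ℂ) 2

/-- The basis vector of the full Fock space that is labelled by a word. -/
def basisVec {n : ℕ} (w : List (Fin n)) : Fock n := lp.single 2 w (1 : ℂ)

/-- The vacuum vector `1`. -/
def vac (n : ℕ) : Fock n := basisVec []

theorem inner_basisVec {n : ℕ} (w : List (Fin n)) (x : Fock n) :
    ⟪basisVec w, x⟫_ℂ = x w := by
  simp [basisVec, lp.inner_single_left]

theorem orthonormal_basisVec (n : ℕ) : Orthonormal ℂ (basisVec : List (Fin n) → Fock n) := by
  rw [orthonormal_iff_ite]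
  intro v w
  rw [inner_basisVec]
  by_cases h : v = w
  · subst h; simp [basisVec]
  · simp [basisVec, h]

theorem orthonormal_cons {n : ℕ} (j : Fin n) :
    Orthonormal ℂ (fun w : List (Fin n) => (basisVec (j :: w) : Fock n)) :=
  (orthonormal_basisVec n).comp (fun w => j :: w) (List.cons_injective)

/-- The left creation operator: the isometry of the Fock space with
`S_j (e_{i₁} ⊗ ⋯ ⊗ e_{iₘ}) = e_j ⊗ e_{i₁} ⊗ ⋯ ⊗ e_{iₘ}`. -/
def creation {n : ℕ} (j : Fin n) : Fock n →L[ℂ] Fock n :=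
  (orthonormal_cons j).orthogonalFamily.linearIsometry.toContinuousLinearMap

theorem creation_basisVec {n : ℕ} (j : Fin n) (w : List (Fin n)) :
    creation j (basisVec w) = basisVec (j :: w) := by
  change (orthonormal_cons j).orthogonalFamily.linearIsometry (lp.single 2 w (1 : ℂ)) = _
  rw [OrthogonalFamily.linearIsometry_apply_single]
  simp

/-! ### The noncommutative Hardy algebra -/

/-- The noncommutative Hardy algebra `F_n^∞`: the closure, in the weak operator topology, of the
unital algebra generated by the left creation operators. As a subspace of the space of bounded
operators with the weak operator topology it carries that topology, which on `F_n^∞` is the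
weak* topology. -/
def hardyAlg (n : ℕ) : Subalgebra ℂ (Fock n →WOT[ℂ] Fock n) :=
  (Algebra.adjoin ℂ
    (Set.range fun j : Fin n => ContinuousLinearMapWOT.ofCLM (creation j))).topologicalClosure

/-- The noncommutative Hardy algebra as a type. -/
abbrev FInf (n : ℕ) : Type := hardyAlg n

/-- The bounded operator underlying an element of `F_n^∞`. -/
def toOp {n : ℕ} (φ : FInf n) : Fock n →L[ℂ] Fock n := ContinuousLinearMapWOT.toCLM φ.1

/-- The left creation operators as elements of `F_n^∞`. -/
def S {n : ℕ} (j : Fin n) : FInf n :=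
  ⟨ContinuousLinearMapWOT.ofCLM (creation j),
    Subalgebra.le_topologicalClosure _ (Algebra.subset_adjoin ⟨j, rfl⟩)⟩

/-! ### Evaluation at the points of the ball -/

/-- The monomial `z_{i₁} ⋯ z_{iₘ}`. -/
def monomial {n : ℕ} (z : Cn n) (w : List (Fin n)) : ℂ := (w.map fun i => z i).prod

theorem summable_monomial {n : ℕ} (z : Ball n) :
    Summable fun w : List (Fin n) => ‖monomial z.1 w‖ ^ 2 := by
  have hz : ‖z.1‖ < 1 := mem_ball_zero_iff.1 z.2
  rw [← (List.equivSigmaTuple (α := Fin n)).symm.summable_iff]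
  have key : ∀ (k : ℕ) (f : Fin k → Fin n),
      ‖monomial z.1 (List.equivSigmaTuple.symm ⟨k, f⟩)‖ ^ 2 = ∏ i, ‖z.1 (f i)‖ ^ 2 := by
    intro k f
    change ‖monomial z.1 (List.ofFn f)‖ ^ 2 = _
    rw [monomial, List.map_ofFn, List.prod_ofFn, norm_prod, Finset.prod_pow]
    rfl
  have hk : ∀ k : ℕ, ∑ f : Fin k → Fin n, ∏ i, ‖z.1 (f i)‖ ^ 2 = (‖z.1‖ ^ 2) ^ k := by
    intro k
    rw [EuclideanSpace.norm_sq_eq, Fintype.sum_pow]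
  refine (summable_sigma_of_nonneg (fun x => sq_nonneg (‖monomial z.1 (List.equivSigmaTuple.symm x)‖))).2 ?_
  refine ⟨fun k => Summable.of_finite, ?_⟩
  have : (fun k : ℕ => ∑' f : Fin k → Fin n,
      ‖monomial z.1 (List.equivSigmaTuple.symm ⟨k, f⟩)‖ ^ 2) = fun k => (‖z.1‖ ^ 2) ^ k := by
    funext k
    rw [tsum_fintype, ← hk k]
    exact Finset.sum_congr rfl fun f _ => key k f
  rw [this]
  exact summable_geometric_of_lt_one (by positivity) (by nlinarith [norm_nonneg z.1])

theorem memlp_monomial {n : ℕ} (z : Ball n) :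
    Memℓp (E := fun _ : List (Fin n) => ℂ) (fun w => star (monomial z.1 w)) 2 := by
  rw [memℓp_gen_iff (by simp)]
  simpa using summable_monomial z

/-- The vector `∑_w conj (z^w) e_w` of the Fock space. -/
def kernelVec {n : ℕ} (z : Ball n) : Fock n :=
  ⟨fun w => star (monomial z.1 w), memlp_monomial z⟩

theorem inner_kernelVec {n : ℕ} (z : Ball n) (w : List (Fin n)) :
    ⟪kernelVec z, basisVec w⟫_ℂ = monomial z.1 w := by
  rw [← inner_conj_symm, inner_basisVec]
  simp [kernelVec]

theorem inner_kernelVec_creation {n : ℕ} (z : Ball n) (j : Fin n) (x : Fock n) :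
    ⟪kernelVec z, creation j x⟫_ℂ = z.1 j * ⟪kernelVec z, x⟫_ℂ := by
  have h1 : HasSum (fun w => x w • (basisVec (j :: w) : Fock n)) (creation j x) := by
    have := (orthonormal_cons j).orthogonalFamily.hasSum_linearIsometry x
    simp only [LinearIsometry.toSpanSingleton_apply] at this
    exact this
  have h2 := h1.mapL (innerSL ℂ (kernelVec z))
  have h3 : HasSum (fun w => z.1 j * (x w * monomial z.1 w)) (z.1 j * ⟪kernelVec z, x⟫_ℂ) := by
    refine HasSum.mul_left _ ?_
    have := lp.hasSum_inner (𝕜 := ℂ) (kernelVec z) x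
    simpa [kernelVec, mul_comm] using this
  have h4 : ∀ w : List (Fin n), innerSL ℂ (kernelVec z) (x w • (basisVec (j :: w) : Fock n)) =
      z.1 j * (x w * monomial z.1 w) := by
    intro w
    change ⟪kernelVec z, x w • (basisVec (j :: w) : Fock n)⟫_ℂ = _
    rw [inner_smul_right, inner_kernelVec]
    simp only [monomial, List.map_cons, List.prod_cons]
    ring
  exact h2.unique ((funext h4 : _ = _) ▸ h3)

theorem inner_kernelVec_apply {n : ℕ} (z : Ball n) (φ : FInf n) (x : Fock n) :
    ⟪kernelVec z, toOp φ x⟫_ℂ = ⟪kernelVec z, toOp φ (vac n)⟫_ℂ * ⟪kernelVec z, x⟫_ℂ := by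
  have hc : ∀ y : Fock n, Continuous fun A : Fock n →WOT[ℂ] Fock n => ⟪kernelVec z, A y⟫_ℂ :=
    fun y => ContinuousLinearMapWOT.continuous_dual_apply y (innerSL ℂ (kernelVec z))
  have hcl : IsClosed {A : Fock n →WOT[ℂ] Fock n | ∀ x : Fock n,
      ⟪kernelVec z, A x⟫_ℂ = ⟪kernelVec z, A (vac n)⟫_ℂ * ⟪kernelVec z, x⟫_ℂ} := by
    simp only [Set.ofPred_forall]
    exact isClosed_iInter fun x => isClosed_eq (hc x) ((hc _).mul continuous_const)
  have h1 : ⟪kernelVec z, vac n⟫_ℂ = 1 := by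
    rw [vac, inner_kernelVec]; simp [monomial]
  refine closure_minimal (s := (Algebra.adjoin ℂ (Set.range fun j : Fin n =>
    ContinuousLinearMapWOT.ofCLM (creation j)) : Set (Fock n →WOT[ℂ] Fock n)))
    (fun A hA => ?_) hcl φ.2 x
  induction hA using Algebra.adjoin_induction with
  | mem A hA =>
    obtain ⟨j, rfl⟩ := hA
    intro x
    simp only [ContinuousLinearMapWOT.ofCLM_apply, inner_kernelVec_creation, h1, mul_one]
  | algebraMap c =>
    intro x
    simp [h1]
  | add A B _ _ hA hB =>
    intro x
    simp only [ContinuousLinearMapWOT.add_apply, inner_add_right, hA x, hB x, add_mul]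
  | mul A B _ _ hA hB =>
    intro x
    simp only [ContinuousLinearMapWOT.mul_apply]
    rw [hA (B x), hA (B (vac n)), hB x, mul_assoc]

/-- Evaluation `φ ↦ φ(z)` at a point of the ball, that is, the representation `π_z`: the unital
algebra homomorphism `F_n^∞ → ℂ` that is continuous for the weak operator topology and maps `S_j`
to `z_j` (see the three facts below). -/
def eval {n : ℕ} (z : Ball n) : FInf n →ₐ[ℂ] ℂ where
  toFun φ := ⟪kernelVec z, toOp φ (vac n)⟫_ℂ
  map_one' := by
    change ⟪kernelVec z, vac n⟫_ℂ = 1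
    rw [vac, inner_kernelVec]; simp [monomial]
  map_zero' := by
    change ⟪kernelVec z, (0 : Fock n)⟫_ℂ = 0
    exact inner_zero_right _
  map_mul' φ ψ := inner_kernelVec_apply z φ (toOp ψ (vac n))
  map_add' φ ψ := inner_add_right _ _ _
  commutes' c := by
    change ⟪kernelVec z, c • vac n⟫_ℂ = c
    rw [inner_smul_right, vac, inner_kernelVec]; simp [monomial]

theorem eval_S {n : ℕ} (z : Ball n) (j : Fin n) : eval z (S j) = z.1 j := by
  change ⟪kernelVec z, creation j (vac n)⟫_ℂ = _
  rw [inner_kernelVec_creation, vac, inner_kernelVec]; simp [monomial]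

theorem continuous_eval {n : ℕ} (z : Ball n) : Continuous (eval z) :=
  (ContinuousLinearMapWOT.continuous_dual_apply (vac n) (innerSL ℂ (kernelVec z))).comp
    continuous_subtype_val

theorem eval_unique {n : ℕ} (z : Ball n) (π : FInf n →ₐ[ℂ] ℂ) (hπ : Continuous π)
    (h : ∀ j, π (S j) = z.1 j) : π = eval z := by
  have hle : Algebra.adjoin ℂ (Set.range fun j : Fin n =>
      ContinuousLinearMapWOT.ofCLM (creation j)) ≤ hardyAlg n :=
    Subalgebra.le_topologicalClosure _
  have h1 : ∀ A : Fock n →WOT[ℂ] Fock n, ∀ hA : A ∈ Algebra.adjoin ℂ (Set.range fun j : Fin n =>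
      ContinuousLinearMapWOT.ofCLM (creation j)), π ⟨A, hle hA⟩ = eval z ⟨A, hle hA⟩ := by
    intro A hA
    induction hA using Algebra.adjoin_induction with
    | mem A hA =>
      obtain ⟨j, rfl⟩ := hA
      exact (h j).trans (eval_S z j).symm
    | algebraMap c => exact (π.commutes c).trans ((eval z).commutes c).symm
    | add A B hA hB iA iB =>
      have e : (⟨A + B, hle (add_mem hA hB)⟩ : FInf n) = ⟨A, hle hA⟩ + ⟨B, hle hB⟩ := rfl
      rw [e, map_add, map_add, iA, iB]
    | mul A B hA hB iA iB =>
      have e : (⟨A * B, hle (mul_mem hA hB)⟩ : FInf n) = ⟨A, hle hA⟩ * ⟨B, hle hB⟩ := rfl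
      rw [e, map_mul, map_mul, iA, iB]
  have hd : DenseRange (Set.inclusion hle : _ → FInf n) :=
    denseRange_inclusion_iff hle |>.2 subset_rfl
  refine DFunLike.coe_injective (hd.equalizer hπ (continuous_eval z) ?_)
  funext A
  exact h1 A.1 A.2

/-! ### Nevanlinna ideals, their quotients, spectral closures -/

/-- The Nevanlinna ideal of `Δ`. -/
def nevanlinna {n : ℕ} (Δ : Set (Ball n)) : Ideal (FInf n) where
  carrier := {φ | ∀ z ∈ Δ, eval z φ = 0}
  zero_mem' z _ := map_zero _
  add_mem' hφ hψ z hz := by rw [map_add, hφ z hz, hψ z hz, add_zero]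
  smul_mem' c φ hφ z hz := by rw [smul_eq_mul, map_mul, hφ z hz, mul_zero]

instance nevanlinna_isTwoSided {n : ℕ} (Δ : Set (Ball n)) : (nevanlinna Δ).IsTwoSided :=
  ⟨fun b hφ z hz => by rw [map_mul, hφ z hz, zero_mul]⟩

/-- The quotient algebra `F_n^∞ / 𝒩_Δ`. -/
abbrev QuotAlg {n : ℕ} (Δ : Set (Ball n)) : Type := FInf n ⧸ nevanlinna Δ

/-- The canonical projection `F_n^∞ → F_n^∞ / 𝒩_Δ`. -/
def proj {n : ℕ} (Δ : Set (Ball n)) : FInf n →ₐ[ℂ] QuotAlg Δ :=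
  Ideal.Quotient.mkₐ ℂ (nevanlinna Δ)

/-- The spectral closure of `Δ`: the common zero set in the ball of the Nevanlinna ideal. -/
def specClosure {n : ℕ} (Δ : Set (Ball n)) : Set (Ball n) :=
  {z | ∀ φ ∈ nevanlinna Δ, eval z φ = 0}

/-- Evaluation of the elements of `F_n^∞ / 𝒩_Δ` at the points of the spectral closure. -/
def quotEval {n : ℕ} (Δ : Set (Ball n)) (z : specClosure Δ) : QuotAlg Δ →ₐ[ℂ] ℂ :=
  Ideal.Quotient.liftₐ (nevanlinna Δ) (eval z.1) z.2

/-- The weak* topology of `F_n^∞ / 𝒩_Δ`, which is the dual of the polar of `𝒩_Δ` in the predual of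
`F_n^∞`. The predual consists of the weak* continuous linear functionals on `F_n^∞`, and
those that vanish on `𝒩_Δ` are the linear functionals on the quotient whose composition with the
projection is weak* continuous; the topology is the coarsest that makes all of them continuous. -/
@[reducible] def weakStar {n : ℕ} (Δ : Set (Ball n)) : TopologicalSpace (QuotAlg Δ) :=
  ⨅ f : {f : QuotAlg Δ →ₗ[ℂ] ℂ // Continuous fun φ : FInf n => f (proj Δ φ)},
    TopologicalSpace.induced f.1 inferInstance

/-! ### The operator space structure -/

/-- The operator on `(F²)^k` that is given by a `k × k` matrix over `F_n^∞`. -/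
def matOp {n k : ℕ} (A : Matrix (Fin k) (Fin k) (FInf n)) :
    PiLp 2 (fun _ : Fin k => Fock n) →L[ℂ] PiLp 2 (fun _ : Fin k => Fock n) :=
  (PiLp.continuousLinearEquiv 2 ℂ (fun _ : Fin k => Fock n)).symm.toContinuousLinearMap ∘L
    ContinuousLinearMap.pi fun i => ∑ j, toOp (A i j) ∘L PiLp.proj 2 (fun _ : Fin k => Fock n) j

/-- The norm of `M_k(F_n^∞ / 𝒩_Δ) = M_k(F_n^∞) / M_k(𝒩_Δ)`: the quotient norm. -/
def quotMatNorm {n k : ℕ} (Δ : Set (Ball n)) (B : Matrix (Fin k) (Fin k) (QuotAlg Δ)) : ℝ :=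
  sInf {r : ℝ | ∃ A : Matrix (Fin k) (Fin k) (FInf n), A.map (proj Δ) = B ∧ r = ‖matOp A‖}

/-! ### Automorphism groups -/

/-- The group of weak* continuous completely isometric automorphisms of `F_n^∞ / 𝒩_Δ` (continuity
is asked of the automorphism and of its inverse). -/
def autGroup {n : ℕ} (Δ : Set (Ball n)) : Subgroup (QuotAlg Δ ≃ₐ[ℂ] QuotAlg Δ) where
  carrier := {Φ | @Continuous _ _ (weakStar Δ) (weakStar Δ) Φ ∧
    @Continuous _ _ (weakStar Δ) (weakStar Δ) Φ.symm ∧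
    ∀ (k : ℕ) (B : Matrix (Fin k) (Fin k) (QuotAlg Δ)),
      quotMatNorm Δ (B.map Φ) = quotMatNorm Δ B}
  one_mem' := ⟨@continuous_id _ (weakStar Δ), @continuous_id _ (weakStar Δ), fun _ _ => rfl⟩
  mul_mem' {Φ Ψ} hΦ hΨ := by
    let _ := weakStar Δ
    refine ⟨?_, ?_, fun k B => (hΦ.2.2 k (B.map Ψ)).trans (hΨ.2.2 k B)⟩
    · exact (Continuous.comp hΦ.1 hΨ.1 : Continuous (Φ ∘ Ψ))
    · exact (Continuous.comp hΨ.2.1 hΦ.2.1 : Continuous (Ψ.symm ∘ Φ.symm))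
  inv_mem' {Φ} hΦ := ⟨hΦ.2.1, hΦ.1, fun k B => by
    have h1 := hΦ.2.2 k (B.map Φ.symm)
    have h2 : (B.map Φ.symm).map Φ = B := by
      ext i j
      exact Φ.apply_symm_apply (B i j)
    rw [h2] at h1
    exact h1.symm⟩

/-- The dual map of an automorphism `Φ`, on the spectral closure:
`λ ↦ (Φ⁻¹(S₁)(λ), …, Φ⁻¹(Sₙ)(λ))`. -/
def dualMap {n : ℕ} (Δ : Set (Ball n)) (Φ : autGroup Δ) (z : specClosure Δ) : Cn n :=
  WithLp.toLp 2 fun j => quotEval Δ z (Φ.1.symm (proj Δ (S j)))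

/-- The matrix `diag(1, …, 1, -1)` of the Hermitian form `∑ |z_j|² - |t|²` on `ℂⁿ × ℂ`. -/
def formMatrix (n : ℕ) : Matrix (Fin n ⊕ Unit) (Fin n ⊕ Unit) ℂ :=
  Matrix.diagonal (Sum.elim (fun _ => 1) fun _ => -1)

/-- The group `SU(n,1)`. -/
def SUn1 (n : ℕ) : Subgroup (Matrix.SpecialLinearGroup (Fin n ⊕ Unit) ℂ) where
  carrier := {M | M.1.conjTranspose * formMatrix n * M.1 = formMatrix n}
  one_mem' := by simp
  mul_mem' {M N} hM hN := by
    simp only [Set.mem_ofPred_eq] at hM hN ⊢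
    change (M.1 * N.1).conjTranspose * formMatrix n * (M.1 * N.1) = _
    rw [Matrix.conjTranspose_mul]
    calc _ = N.1.conjTranspose * (M.1.conjTranspose * formMatrix n * M.1) * N.1 := by
          simp only [Matrix.mul_assoc]
      _ = _ := by rw [hM, hN]
  inv_mem' {M} hM := by
    simp only [Set.mem_ofPred_eq] at hM ⊢
    have h1 : M.1 * (M⁻¹).1 = 1 := congrArg Subtype.val (mul_inv_cancel M)
    have h2 : (M⁻¹).1.conjTranspose * M.1.conjTranspose = 1 := by
      rw [← Matrix.conjTranspose_mul, h1, Matrix.conjTranspose_one]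
    calc _ = (M⁻¹).1.conjTranspose * (M.1.conjTranspose * formMatrix n * M.1) * (M⁻¹).1 := by
          rw [hM]
      _ = ((M⁻¹).1.conjTranspose * M.1.conjTranspose) * formMatrix n * (M.1 * (M⁻¹).1) := by
          simp only [Matrix.mul_assoc]
      _ = _ := by rw [h1, h2, Matrix.one_mul, Matrix.mul_one]

/-- The vector `(z, 1)` of `ℂⁿ × ℂ`. -/
def homog {n : ℕ} (z : Ball n) : Fin n ⊕ Unit → ℂ := Sum.elim (fun j => z.1 j) fun _ => 1

/-- The matrix `M` induces the transformation `γ` of the ball: `γ(z)` is the point of the ball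
whose homogeneous coordinates are `M (z, 1)`. -/
def Induces {n : ℕ} (M : Matrix.SpecialLinearGroup (Fin n ⊕ Unit) ℂ)
    (γ : Equiv.Perm (Ball n)) : Prop :=
  ∀ z : Ball n, ∃ c : ℂ, M.1.mulVec (homog z) = c • homog (γ z)

theorem Induces.mul {n : ℕ} {M N : Matrix.SpecialLinearGroup (Fin n ⊕ Unit) ℂ}
    {γ δ : Equiv.Perm (Ball n)} (hM : Induces M γ) (hN : Induces N δ) :
    Induces (M * N) (γ * δ) := by
  intro z
  obtain ⟨c, hc⟩ := hN z
  obtain ⟨d, hd⟩ := hM (δ z)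
  refine ⟨c * d, ?_⟩
  change (M.1 * N.1).mulVec (homog z) = (c * d) • homog (γ (δ z))
  rw [← Matrix.mulVec_mulVec, hc, Matrix.mulVec_smul, hd, smul_smul]

theorem Induces.inv {n : ℕ} {M : Matrix.SpecialLinearGroup (Fin n ⊕ Unit) ℂ}
    {γ : Equiv.Perm (Ball n)} (hM : Induces M γ) : Induces M⁻¹ γ⁻¹ := by
  intro z
  obtain ⟨c, hc⟩ := hM (γ⁻¹ z)
  rw [show γ (γ⁻¹ z) = z from γ.apply_symm_apply z] at hc
  have h1 : (M⁻¹).1 * M.1 = 1 := congrArg Subtype.val (inv_mul_cancel M)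
  have h2 : homog (γ⁻¹ z) = c • (M⁻¹).1.mulVec (homog z) := by
    rw [← Matrix.mulVec_smul, ← hc, Matrix.mulVec_mulVec, h1, Matrix.one_mulVec]
  have hc0 : c ≠ 0 := by
    rintro rfl
    have := congrFun h2 (Sum.inr ())
    simp [homog] at this
  refine ⟨c⁻¹, ?_⟩
  rw [h2, smul_smul, inv_mul_cancel₀ hc0, one_smul]

/-- The group of the transformations of the ball that are induced by elements of `SU(n,1)` and
map the spectral closure of `Δ` onto itself. -/
def stabGroup {n : ℕ} (Δ : Set (Ball n)) : Subgroup (Equiv.Perm (Ball n)) where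
  carrier := {γ | (∃ M ∈ SUn1 n, Induces M γ) ∧ γ '' specClosure Δ = specClosure Δ}
  one_mem' := ⟨⟨1, one_mem _, fun z => ⟨1, by simp⟩⟩, by simp⟩
  mul_mem' := by
    rintro γ δ ⟨⟨M, hM, hγ⟩, hγ'⟩ ⟨⟨N, hN, hδ⟩, hδ'⟩
    refine ⟨⟨M * N, mul_mem hM hN, hγ.mul hδ⟩, ?_⟩
    rw [Equiv.Perm.coe_mul, Set.image_comp, hδ', hγ']
  inv_mem' := by
    rintro γ ⟨⟨M, hM, hγ⟩, hγ'⟩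
    refine ⟨⟨M⁻¹, inv_mem hM, hγ.inv⟩, ?_⟩
    conv_lhs => rw [← hγ']
    rw [← Set.image_comp, ← Equiv.Perm.coe_mul, inv_mul_cancel]
    simp

/-! ### Biholomorphic maps of the ball -/

/-- A map of the ball into itself is holomorphic. -/
def IsHolo {n : ℕ} (f : Ball n → Ball n) : Prop :=
  ∃ F : Cn n → Cn n, DifferentiableOn ℂ F (Metric.ball 0 1) ∧ ∀ z : Ball n, F z.1 = (f z).1

/-- A bijection of the ball is biholomorphic. -/
def IsBiholo {n : ℕ} (γ : Equiv.Perm (Ball n)) : Prop := IsHolo γ ∧ IsHolo γ.symm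

end NCHardy

end

open scoped InnerProductSpace

noncomputable section

namespace NCHardy

variable {n : ℕ}

/-! Points of the ball are recovered from the algebra as characters. A weak* continuous character of
`FInf n` is evaluation at a point of the open ball: if ∑ |c_j|² ≤ 1, the powers of ∑ c_j S_j tend
weakly to 0, which rules out values on or outside the sphere. Hence evaluation at z composed with
Φ⁻¹ is evaluation at another point `dualPt Φ z` of the spectral closure, and Φ ↦ `dualPt Φ` is a
faithful action by permutations, since the quotient is an algebra of functions on the spectral
closure.

Rigidity comes from a Pick kernel. The row (S_1, …, S_n) has norm at most one, so its image under
Φ⁻¹ lifts to rows of norm below any r > 1. Testing adjoints on the kernel vectors, which are joint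
eigenvectors, shows that (1 - ⟨F z, F w⟩) / (1 - ⟨z, w⟩), with F = `dualPt Φ`, is a positive kernel.
The same argument for Φ⁻¹ makes its reciprocal positive, and `PosKernel.rank_one` then says that it
has rank one. After rescaling, (z, 1) ↦ (F z, 1) therefore preserves the Hermitian form. As the
vectors (z, 1) span, Witt's theorem (`exists_preservesForm_of_form_eq`) extends it to a matrix,
which is scaled into SU(n,1).

Conversely, a matrix M preserving the form sends (S_1, …, S_n, 1) to affine combinations L_1, …,
L_n, L_0. Here L_0 is invertible, and T_j = L_0⁻¹ L_j is a row isometry whose defect is a rank one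
projection. By `PreservesForm.exists_unitary` it is unitarily equivalent to (S_1, …, S_n).
Conjugation by that unitary maps the Hardy algebra into itself and induces the given transformation
on points, so it descends to the quotient if the transformation preserves the spectral closure; the
inverse matrix gives the inverse.

A biholomorphic map of the ball that fixes an affinely spanning set is the identity
(`IsBiholo.eq_one`): after moving a fixed point to the origin, the Schwarz lemma makes the map
linear. This gives uniqueness of extensions, and with it multiplicativity and surjectivity of the
correspondence. -/

/-! ### Creation operators, their adjoints and the Cuntz–Toeplitz relations -/

theorem Fock.ext_basisVec {x y : Fock n} (h : ∀ w, ⟪basisVec w, x⟫_ℂ = ⟪basisVec w, y⟫_ℂ) :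
    x = y := by
  ext w
  simpa only [inner_basisVec] using h w

theorem adjoint_creation_apply (j : Fin n) (x : Fock n) (w : List (Fin n)) :
    (ContinuousLinearMap.adjoint (creation j) x) w = x (j :: w) := by
  rw [← inner_basisVec, ContinuousLinearMap.adjoint_inner_right, creation_basisVec, inner_basisVec]

theorem hasSum_basisVec (x : Fock n) : HasSum (fun w => x w • (basisVec w : Fock n)) x := by
  have h : ∀ w, x w • (basisVec w : Fock n) = lp.single 2 w (x w) := fun w => by
    rw [basisVec, ← lp.single_smul, smul_eq_mul, mul_one]
  simp only [h]
  exact lp.hasSum_single (by norm_num) x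

theorem creation_apply (j : Fin n) (x : Fock n) (v : List (Fin n)) :
    (creation j x) v = ∑' w, x w * (if v = j :: w then 1 else 0) := by
  have h1 : HasSum (fun w => x w • (basisVec (j :: w) : Fock n)) (creation j x) := by
    have := (orthonormal_cons j).orthogonalFamily.hasSum_linearIsometry x
    simp only [LinearIsometry.toSpanSingleton_apply] at this
    exact this
  have h2 := h1.mapL (innerSL ℂ (basisVec v))
  simp only [innerSL_apply_apply, inner_smul_right, orthonormal_iff_ite.1 (orthonormal_basisVec n)] at h2
  rw [h2.tsum_eq, inner_basisVec]

theorem creation_apply_nil (j : Fin n) (x : Fock n) : (creation j x) [] = 0 := by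
  simp [creation_apply]

theorem creation_apply_cons (i j : Fin n) (x : Fock n) (w : List (Fin n)) :
    (creation j x) (i :: w) = if i = j then x w else 0 := by
  rw [creation_apply]
  by_cases h : i = j
  · subst h
    rw [tsum_eq_single w]
    · simp
    · intro v hv
      simp [Ne.symm hv]
  · simp [h]

theorem adjoint_creation_creation (i j : Fin n) (x : Fock n) :
    ContinuousLinearMap.adjoint (creation i) (creation j x) = if i = j then x else 0 := by
  ext w
  rw [adjoint_creation_apply, creation_apply_cons]
  split_ifs <;> simp

theorem inner_creation_creation (i j : Fin n) (x y : Fock n) :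
    ⟪creation i x, creation j y⟫_ℂ = if i = j then ⟪x, y⟫_ℂ else 0 := by
  rw [← ContinuousLinearMap.adjoint_inner_right, adjoint_creation_creation]
  split_ifs <;> simp

theorem inner_vac_creation (j : Fin n) (x : Fock n) : ⟪vac n, creation j x⟫_ℂ = 0 := by
  rw [vac, inner_basisVec, creation_apply_nil]

theorem norm_vac : ‖vac n‖ = 1 := (orthonormal_basisVec n).1 []

theorem sum_creation_adjoint_creation (x : Fock n) :
    ∑ j, creation j (ContinuousLinearMap.adjoint (creation j) x) = x - ⟪vac n, x⟫_ℂ • vac n := by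
  refine Fock.ext_basisVec fun w => ?_
  rw [inner_sum, inner_sub_right, inner_smul_right]
  simp only [vac, orthonormal_iff_ite.1 (orthonormal_basisVec n)]
  simp only [inner_basisVec]
  cases w with
  | nil => simp [creation_apply_nil]
  | cons i w => simp [creation_apply_cons, adjoint_creation_apply]

theorem norm_sq_eq_inner (x : Fock n) : (‖x‖ : ℂ) ^ 2 = ⟪x, x⟫_ℂ :=
  (inner_self_eq_norm_sq_to_K x).symm

theorem norm_sum_creation_sq (x : Fin n → Fock n) :
    ‖∑ j, creation j (x j)‖ ^ 2 = ∑ j, ‖x j‖ ^ 2 := by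
  have : ((‖∑ j, creation j (x j)‖ ^ 2 : ℝ) : ℂ) = ((∑ j, ‖x j‖ ^ 2 : ℝ) : ℂ) := by
    push_cast
    simp only [norm_sq_eq_inner, sum_inner, inner_sum, inner_creation_creation]
    simp
  exact_mod_cast this

/-- The combination `∑ c_j S_j` of the left creation operators. -/
def rowOp (c : Fin n → ℂ) : Fock n →L[ℂ] Fock n := ∑ j, c j • creation j

theorem rowOp_apply (c : Fin n → ℂ) (x : Fock n) : rowOp c x = ∑ j, c j • creation j x := by
  simp [rowOp]

theorem norm_rowOp_apply (c : Fin n → ℂ) (x : Fock n) :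
    ‖rowOp c x‖ ^ 2 = (∑ j, ‖c j‖ ^ 2) * ‖x‖ ^ 2 := by
  have := norm_sum_creation_sq fun j => c j • x
  simp only [map_smul, norm_smul, mul_pow, ← Finset.sum_mul] at this
  rw [rowOp_apply, this]

/-! ### Weak* continuous characters -/

section Characters

open Filter Topology

/-- Each factor lengthens words by one letter, so only words of length at least k survive. -/
theorem rowOp_pow_apply_eq_zero (c : Fin n → ℂ) (k : ℕ) (x : Fock n) (w : List (Fin n))
    (hw : w.length < k) : ((rowOp c ^ k) x) w = 0 := by
  induction k generalizing w with
  | zero => simp at hw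
  | succ k ih =>
    rw [pow_succ', mul_apply_eq_comp, rowOp_apply, ← inner_basisVec, inner_sum]
    refine Finset.sum_eq_zero fun j _ => ?_
    rw [inner_smul_right, inner_basisVec]
    cases w with
    | nil => rw [creation_apply_nil, mul_zero]
    | cons i w =>
      rw [creation_apply_cons]
      split_ifs
      · rw [ih w (by simpa using hw), mul_zero]
      · rw [mul_zero]

theorem norm_rowOp_pow_apply_le {c : Fin n → ℂ} (hc : ∑ j, ‖c j‖ ^ 2 ≤ 1) (k : ℕ) (x : Fock n) :
    ‖(rowOp c ^ k) x‖ ≤ ‖x‖ := by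
  induction k with
  | zero => simp
  | succ k ih =>
    rw [pow_succ', mul_apply_eq_comp]
    refine le_trans (le_of_sq_le_sq ?_ (norm_nonneg _)) ih
    rw [norm_rowOp_apply]
    exact mul_le_of_le_one_left (sq_nonneg _) hc

/-- Approximate y by a finitely supported vector, which is orthogonal to the range of high powers;
contractivity controls the remainder. Only weak convergence is possible, as the powers are isometric
when ∑ |c_j|² = 1. -/
theorem tendsto_inner_rowOp_pow {c : Fin n → ℂ} (hc : ∑ j, ‖c j‖ ^ 2 ≤ 1) (x y : Fock n) :
    Tendsto (fun k => ⟪y, (rowOp c ^ k) x⟫_ℂ) atTop (𝓝 0) := by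
  rw [Metric.tendsto_atTop]
  intro ε hε
  obtain ⟨s, hs⟩ := ((Metric.tendsto_nhds.1 (hasSum_basisVec y)) (ε / (‖x‖ + 1))
    (by positivity)).exists
  refine ⟨s.sup List.length + 1, fun k hk => ?_⟩
  have h0 : ⟪∑ w ∈ s, y w • (basisVec w : Fock n), (rowOp c ^ k) x⟫_ℂ = 0 := by
    rw [sum_inner]
    refine Finset.sum_eq_zero fun w hw => ?_
    rw [inner_smul_left, inner_basisVec, rowOp_pow_apply_eq_zero, mul_zero]
    have := Finset.le_sup (f := List.length) hw
    omega
  rw [dist_zero_right, ← sub_zero ⟪y, _⟫_ℂ, ← h0, ← inner_sub_left]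
  rw [dist_comm, dist_eq_norm] at hs
  have hx : (0 : ℝ) < ‖x‖ + 1 := by positivity
  calc _ ≤ _ := norm_inner_le_norm _ _
    _ ≤ ‖y - ∑ w ∈ s, y w • (basisVec w : Fock n)‖ * ‖x‖ := by
        gcongr; exact norm_rowOp_pow_apply_le hc k x
    _ ≤ ‖y - ∑ w ∈ s, y w • (basisVec w : Fock n)‖ * (‖x‖ + 1) := by gcongr; linarith
    _ < ε := (lt_div_iff₀ hx).1 hs

/-- The element `∑ c_j S_j` of the noncommutative Hardy algebra. -/
def row (c : Fin n → ℂ) : FInf n := ∑ j, c j • S j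

theorem toOp_row (c : Fin n → ℂ) : toOp (row c) = rowOp c := by
  have : toOp (row c) =
      ContinuousLinearMapWOT.algEquiv (E := Fock n) ℂ ((hardyAlg n).val (∑ j, c j • S j)) := rfl
  rw [this]
  simp only [map_sum, map_smul]
  rfl

/-- The values of a weak* continuous character at the left creation operators form a point of the
open ball. -/
theorem sum_norm_sq_character_lt_one (π : FInf n →ₐ[ℂ] ℂ) (hπ : Continuous π) :
    ∑ j, ‖π (S j)‖ ^ 2 < 1 := by
  by_contra! h
  set r : ℝ := ∑ j, ‖π (S j)‖ ^ 2 with hr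
  -- Chosen so that the character has value 1 at ∑ c_j S_j, and hence at all its powers, while ∑
  -- |c_j|² = 1 / r ≤ 1 makes these powers tend weakly to 0.
  set c : Fin n → ℂ := fun j => star (π (S j)) / (r : ℂ) with hc
  have hr0 : 0 < r := by linarith
  have hc1 : ∑ j, ‖c j‖ ^ 2 ≤ 1 := by
    have : ∑ j, ‖c j‖ ^ 2 = r / r ^ 2 := by
      simp only [hc, norm_div, norm_star, div_pow, ← Finset.sum_div, ← hr, Complex.norm_real,
        Real.norm_eq_abs, sq_abs]
    rw [this, div_le_one (by positivity)]
    nlinarith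
  have hval : π (row c) = 1 := by
    have : ∀ j, c j * π (S j) = ((‖π (S j)‖ ^ 2 : ℝ) : ℂ) / r := fun j => by
      have := Complex.conj_mul' (π (S j))
      simp only [hc, Complex.star_def, div_mul_eq_mul_div, this]
      push_cast; rfl
    simp only [row, map_sum, map_smul, smul_eq_mul, this]
    rw [← Finset.sum_div, ← Complex.ofReal_sum, ← hr, div_self]
    exact_mod_cast hr0.ne'
  have ht : Tendsto (fun k => row c ^ k) atTop (𝓝 (0 : FInf n)) := by
    rw [tendsto_subtype_rng, ContinuousLinearMapWOT.tendsto_iff_forall_inner_apply_tendsto]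
    intro x y
    have := tendsto_inner_rowOp_pow hc1 x y
    rw [← toOp_row] at this
    simp only [ContinuousLinearMapWOT.zero_apply, ZeroMemClass.coe_zero, inner_zero_right]
    exact this
  have h1 := (hπ.tendsto 0).comp ht
  simp only [Function.comp_def, map_pow, hval, one_pow, map_zero] at h1
  exact one_ne_zero (tendsto_nhds_unique tendsto_const_nhds h1)

theorem exists_eq_eval (π : FInf n →ₐ[ℂ] ℂ) (hπ : Continuous π) :
    ∃ z : Ball n, π = eval z := by
  refine ⟨⟨WithLp.toLp 2 fun j => π (S j), ?_⟩, eval_unique _ π hπ fun j => rfl⟩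
  have h := sum_norm_sq_character_lt_one π hπ
  rw [mem_ball_zero_iff, ← sq_lt_one_iff₀ (norm_nonneg _), EuclideanSpace.norm_sq_eq]
  exact h

/-! ### The dual map -/

variable {Δ : Set (Ball n)}

theorem subset_specClosure : Δ ⊆ specClosure Δ := fun z hz _ hφ => hφ z hz

theorem quotEval_proj (z : specClosure Δ) (φ : FInf n) :
    quotEval Δ z (proj Δ φ) = eval z.1 φ := rfl

theorem proj_surjective : Function.Surjective (proj Δ) := Ideal.Quotient.mk_surjective

theorem QuotAlg.ext_quotEval {a b : QuotAlg Δ} (h : ∀ z, quotEval Δ z a = quotEval Δ z b) :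
    a = b := by
  obtain ⟨φ, rfl⟩ := proj_surjective a
  obtain ⟨ψ, rfl⟩ := proj_surjective b
  refine Ideal.Quotient.eq.2 fun z hz => ?_
  rw [map_sub, sub_eq_zero]
  exact h ⟨z, subset_specClosure hz⟩

theorem continuous_proj : @Continuous _ _ _ (weakStar Δ) (proj Δ) := by
  let _ := weakStar Δ
  exact continuous_iInf_rng.2 fun f => continuous_induced_rng.2 f.2

theorem continuous_weakStar_of_comp_proj {f : QuotAlg Δ →ₗ[ℂ] ℂ}
    (hf : Continuous fun φ : FInf n => f (proj Δ φ)) : @Continuous _ _ (weakStar Δ) _ f :=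
  continuous_iInf_dom (i := ⟨f, hf⟩) continuous_induced_dom

/-- The composite of the projection, Φ⁻¹ and evaluation at z is a weak* continuous character, hence
an evaluation at a point of the ball. It kills the Nevanlinna ideal, so that point lies in the
spectral closure. -/
theorem exists_quotEval_symm (Φ : autGroup Δ) (z : specClosure Δ) :
    ∃ w : specClosure Δ, ∀ a, quotEval Δ z (Φ.1.symm a) = quotEval Δ w a := by
  let π : FInf n →ₐ[ℂ] ℂ := (quotEval Δ z).comp (Φ.1.symm.toAlgHom.comp (proj Δ))
  have hπ : Continuous π := by
    let _ := weakStar Δ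
    have h1 : Continuous (quotEval Δ z) :=
      continuous_weakStar_of_comp_proj (f := (quotEval Δ z).toLinearMap) (continuous_eval z.1)
    exact h1.comp (Φ.2.2.1.comp continuous_proj)
  obtain ⟨w, hw⟩ := exists_eq_eval π hπ
  have hwV : w ∈ specClosure Δ := fun φ hφ => by
    rw [← hw]
    have : proj Δ φ = 0 := Ideal.Quotient.eq_zero_iff_mem.2 hφ
    change quotEval Δ z (Φ.1.symm (proj Δ φ)) = 0
    rw [this, map_zero, map_zero]
  refine ⟨⟨w, hwV⟩, fun a => ?_⟩
  obtain ⟨φ, rfl⟩ := proj_surjective a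
  exact DFunLike.congr_fun hw φ

/-- The dual map of an automorphism as a self-map of the spectral closure. -/
def dualPt (Φ : autGroup Δ) (z : specClosure Δ) : specClosure Δ :=
  (exists_quotEval_symm Φ z).choose

theorem quotEval_symm (Φ : autGroup Δ) (z : specClosure Δ) (a : QuotAlg Δ) :
    quotEval Δ z (Φ.1.symm a) = quotEval Δ (dualPt Φ z) a :=
  (exists_quotEval_symm Φ z).choose_spec a

theorem dualMap_eq (Φ : autGroup Δ) (z : specClosure Δ) : dualMap Δ Φ z = (dualPt Φ z).1.1 := by
  ext j
  change quotEval Δ z (Φ.1.symm (proj Δ (S j))) = _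
  rw [quotEval_symm, quotEval_proj, eval_S]

theorem specClosure_ext {z w : specClosure Δ} (h : ∀ a, quotEval Δ z a = quotEval Δ w a) :
    z = w := by
  ext j
  have := h (proj Δ (S j))
  rwa [quotEval_proj, quotEval_proj, eval_S, eval_S] at this

theorem dualPt_mul (Φ Ψ : autGroup Δ) (z : specClosure Δ) :
    dualPt (Φ * Ψ) z = dualPt Φ (dualPt Ψ z) := by
  refine specClosure_ext fun a => ?_
  rw [← quotEval_symm, ← quotEval_symm, ← quotEval_symm]
  rfl

theorem dualPt_one (z : specClosure Δ) : dualPt (1 : autGroup Δ) z = z := by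
  refine specClosure_ext fun a => ?_
  rw [← quotEval_symm]
  rfl

theorem dualPt_inv_dualPt (Φ : autGroup Δ) (z : specClosure Δ) :
    dualPt Φ⁻¹ (dualPt Φ z) = z := by
  rw [← dualPt_mul, inv_mul_cancel, dualPt_one]

theorem dualPt_dualPt_inv (Φ : autGroup Δ) (z : specClosure Δ) :
    dualPt Φ (dualPt Φ⁻¹ z) = z := by
  rw [← dualPt_mul, mul_inv_cancel, dualPt_one]

theorem dualPt_injective : Function.Injective (dualPt : autGroup Δ → specClosure Δ → _) := by
  intro Φ Ψ h
  refine Subtype.ext (AlgEquiv.symm_bijective.1 (AlgEquiv.ext fun a => ?_))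
  refine QuotAlg.ext_quotEval fun z => ?_
  rw [quotEval_symm, quotEval_symm, h]

end Characters

open Matrix

/-! ### Matrices that preserve the Hermitian form -/

/-- The Hermitian form `∑ |z_j|² - |t|²` is preserved by the matrix `M`. -/
def PreservesForm (M : Matrix (Fin n ⊕ Unit) (Fin n ⊕ Unit) ℂ) : Prop :=
  Mᴴ * formMatrix n * M = formMatrix n

theorem formMatrix_conjTranspose : (formMatrix n)ᴴ = formMatrix n := by
  rw [formMatrix, diagonal_conjTranspose]
  congr 1
  ext (i | i) <;> simp

theorem formMatrix_mul_self : formMatrix n * formMatrix n = 1 := by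
  rw [formMatrix, diagonal_mul_diagonal, ← diagonal_one]
  congr 1
  ext (i | i) <;> simp

/-- The Hermitian form `∑ conj x_j y_j - conj x_0 y_0`. -/
def form (x y : Fin n ⊕ Unit → ℂ) : ℂ := star x ⬝ᵥ (formMatrix n *ᵥ y)

theorem form_eq (x y : Fin n ⊕ Unit → ℂ) :
    form x y = ∑ j, star (x (Sum.inl j)) * y (Sum.inl j) -
      star (x (Sum.inr ())) * y (Sum.inr ()) := by
  simp [form, formMatrix, dotProduct, mulVec_diagonal, sub_eq_add_neg]

theorem form_homog (z w : Ball n) : form (homog z) (homog w) = ⟪z.1, w.1⟫_ℂ - 1 := by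
  simp [form_eq, homog, PiLp.inner_apply, mul_comm]

theorem form_smul_smul (c d : ℂ) (x y : Fin n ⊕ Unit → ℂ) :
    form (c • x) (d • y) = star c * d * form x y := by
  simp only [form, mulVec_smul, star_smul, smul_dotProduct, dotProduct_smul, smul_eq_mul]
  ring

/-- By Cauchy–Schwarz, |⟨z, w⟩| < 1 in the open ball. -/
theorem form_homog_ne_zero (z w : Ball n) : form (homog z) (homog w) ≠ 0 := by
  rw [form_homog]
  intro h
  have h1 : ‖⟪z.1, w.1⟫_ℂ‖ = 1 := by rw [sub_eq_zero.1 h, norm_one]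
  have h2 := norm_inner_le_norm (𝕜 := ℂ) z.1 w.1
  have hz : ‖z.1‖ < 1 := mem_ball_zero_iff.1 z.2
  have hw : ‖w.1‖ < 1 := mem_ball_zero_iff.1 w.2
  nlinarith [norm_nonneg z.1, norm_nonneg w.1]

theorem PreservesForm.form_mulVec {M : Matrix (Fin n ⊕ Unit) (Fin n ⊕ Unit) ℂ}
    (hM : PreservesForm M) (x y : Fin n ⊕ Unit → ℂ) : form (M *ᵥ x) (M *ᵥ y) = form x y := by
  rw [form, star_mulVec, ← dotProduct_mulVec, mulVec_mulVec, mulVec_mulVec, hM, form]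

theorem PreservesForm.left_inv {M : Matrix (Fin n ⊕ Unit) (Fin n ⊕ Unit) ℂ}
    (hM : PreservesForm M) : (formMatrix n * Mᴴ * formMatrix n) * M = 1 := by
  rw [Matrix.mul_assoc, Matrix.mul_assoc, ← Matrix.mul_assoc (Mᴴ), hM, formMatrix_mul_self]

theorem PreservesForm.right_inv {M : Matrix (Fin n ⊕ Unit) (Fin n ⊕ Unit) ℂ}
    (hM : PreservesForm M) : M * (formMatrix n * Mᴴ * formMatrix n) = 1 :=
  mul_eq_one_comm.1 hM.left_inv

theorem PreservesForm.mul_form_mul {M : Matrix (Fin n ⊕ Unit) (Fin n ⊕ Unit) ℂ}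
    (hM : PreservesForm M) : M * formMatrix n * Mᴴ = formMatrix n := by
  calc M * formMatrix n * Mᴴ
      = M * (formMatrix n * Mᴴ * formMatrix n) * formMatrix n := by
        simp only [Matrix.mul_assoc, formMatrix_mul_self, Matrix.mul_one]
    _ = _ := by rw [hM.right_inv, Matrix.one_mul]

theorem PreservesForm.inv {M : Matrix (Fin n ⊕ Unit) (Fin n ⊕ Unit) ℂ}
    (hM : PreservesForm M) : PreservesForm (formMatrix n * Mᴴ * formMatrix n) := by
  rw [PreservesForm, conjTranspose_mul, conjTranspose_mul, conjTranspose_conjTranspose,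
    formMatrix_conjTranspose]
  calc formMatrix n * (M * formMatrix n) * formMatrix n * (formMatrix n * Mᴴ * formMatrix n)
      = formMatrix n * (M * (formMatrix n * (formMatrix n * formMatrix n)) * Mᴴ)
          * formMatrix n := by
        simp only [Matrix.mul_assoc]
    _ = _ := by
        rw [formMatrix_mul_self, Matrix.mul_one, hM.mul_form_mul, formMatrix_mul_self,
          Matrix.one_mul]

theorem form_self_re (x : Fin n ⊕ Unit → ℂ) :
    form x x = ((∑ j, ‖x (Sum.inl j)‖ ^ 2 - ‖x (Sum.inr ())‖ ^ 2 : ℝ) : ℂ) := by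
  simp [form_eq, Complex.conj_mul']

theorem homog_smul_injective {c d : ℂ} (hc : c ≠ 0) {z w : Ball n}
    (h : c • homog z = d • homog w) : z = w := by
  have h0 : c = d := by simpa [homog] using congrFun h (Sum.inr ())
  subst h0
  have h1 := smul_right_injective _ hc h
  ext j
  simpa [homog] using congrFun h1 (Sum.inl j)

/-- A vector on which the form is negative is proportional to `(z, 1)` for a point `z` of the
ball. -/
theorem exists_eq_smul_homog {x : Fin n ⊕ Unit → ℂ}
    (hx : ∑ j, ‖x (Sum.inl j)‖ ^ 2 - ‖x (Sum.inr ())‖ ^ 2 < 0) :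
    ∃ (c : ℂ) (z : Ball n), c ≠ 0 ∧ x = c • homog z := by
  set c := x (Sum.inr ()) with hc
  have hc0 : c ≠ 0 := by
    intro h
    rw [h, norm_zero] at hx
    have : 0 ≤ ∑ j, ‖x (Sum.inl j)‖ ^ 2 := Finset.sum_nonneg fun _ _ => sq_nonneg _
    linarith [zero_pow (M₀ := ℝ) two_ne_zero]
  refine ⟨c, ⟨WithLp.toLp 2 fun j => x (Sum.inl j) / c, ?_⟩, hc0, ?_⟩
  · have hc1 : 0 < ‖c‖ ^ 2 := by positivity
    rw [mem_ball_zero_iff, ← sq_lt_one_iff₀ (norm_nonneg _), EuclideanSpace.norm_sq_eq]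
    simp only [norm_div, div_pow, ← Finset.sum_div]
    rw [div_lt_one hc1]
    linarith
  · ext (j | j)
    · simp [homog, mul_div_cancel₀ _ hc0]
    · simp [homog, hc]

/-- The matrix `M` moves the points of the ball as `γ` does. -/
def Moves (M : Matrix (Fin n ⊕ Unit) (Fin n ⊕ Unit) ℂ) (γ : Ball n → Ball n) : Prop :=
  ∀ z : Ball n, ∃ c : ℂ, c ≠ 0 ∧ M *ᵥ homog z = c • homog (γ z)

theorem PreservesForm.exists_moves {M : Matrix (Fin n ⊕ Unit) (Fin n ⊕ Unit) ℂ}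
    (hM : PreservesForm M) : ∃ γ : Ball n → Ball n, Moves M γ := by
  have : ∀ z : Ball n, ∃ w : Ball n, ∃ c : ℂ, c ≠ 0 ∧ M *ᵥ homog z = c • homog w := by
    intro z
    obtain ⟨c, w, hc, h⟩ := exists_eq_smul_homog (x := M *ᵥ homog z) (by
      have h1 := hM.form_mulVec (homog z) (homog z)
      rw [form_self_re, form_self_re, Complex.ofReal_inj] at h1
      rw [h1]
      have hz : ‖z.1‖ < 1 := mem_ball_zero_iff.1 z.2
      rw [← sq_lt_one_iff₀ (norm_nonneg _), EuclideanSpace.norm_sq_eq] at hz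
      simpa [homog] using hz)
    exact ⟨w, c, hc, h⟩
  choose γ hγ using this
  exact ⟨γ, hγ⟩

theorem Moves.comp {M N : Matrix (Fin n ⊕ Unit) (Fin n ⊕ Unit) ℂ} {γ δ : Ball n → Ball n}
    (hM : Moves M γ) (hN : Moves N δ) : Moves (M * N) (γ ∘ δ) := by
  intro z
  obtain ⟨c, hc0, hc⟩ := hN z
  obtain ⟨d, hd0, hd⟩ := hM (δ z)
  refine ⟨c * d, mul_ne_zero hc0 hd0, ?_⟩
  rw [← mulVec_mulVec, hc, mulVec_smul, hd, smul_smul, Function.comp]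

theorem Moves.eq_id {γ : Ball n → Ball n} (h : Moves 1 γ) : γ = id := by
  funext z
  obtain ⟨c, hc, h1⟩ := h z
  rw [one_mulVec, ← one_smul ℂ (homog z)] at h1
  exact (homog_smul_injective one_ne_zero h1).symm

theorem PreservesForm.exists_perm {M : Matrix (Fin n ⊕ Unit) (Fin n ⊕ Unit) ℂ}
    (hM : PreservesForm M) : ∃ γ : Equiv.Perm (Ball n), Moves M γ ∧
      Moves (formMatrix n * Mᴴ * formMatrix n) γ.symm := by
  obtain ⟨γ, hγ⟩ := hM.exists_moves
  obtain ⟨δ, hδ⟩ := hM.inv.exists_moves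
  have h1 := hγ.comp hδ
  have h2 := hδ.comp hγ
  rw [hM.right_inv] at h1
  rw [hM.left_inv] at h2
  exact ⟨⟨γ, δ, congrFun h2.eq_id, congrFun h1.eq_id⟩, hγ, hδ⟩

theorem Induces.moves {M : Matrix.SpecialLinearGroup (Fin n ⊕ Unit) ℂ}
    {γ : Equiv.Perm (Ball n)} (hM : Induces M γ) : Moves M.1 γ := by
  intro z
  obtain ⟨c, hc⟩ := hM z
  refine ⟨c, ?_, hc⟩
  rintro rfl
  have h1 : (M⁻¹).1 * M.1 = 1 := congrArg Subtype.val (inv_mul_cancel M)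
  have h2 : homog z = 0 := by
    rw [← Matrix.one_mulVec (homog z), ← h1, ← mulVec_mulVec, hc, zero_smul, mulVec_zero]
  simpa [homog] using congrFun h2 (Sum.inr ())

/-- The determinant has modulus one. Multiplying by an (n+1)-st root of its inverse, also of modulus
one, normalises it without affecting the form or the projective action. -/
theorem PreservesForm.exists_SUn1 {M : Matrix (Fin n ⊕ Unit) (Fin n ⊕ Unit) ℂ}
    (hM : PreservesForm M) {γ : Equiv.Perm (Ball n)} (hγ : Moves M γ) :
    ∃ M' ∈ SUn1 n, Induces M' γ := by
  have hdet : ‖M.det‖ = 1 := by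
    have h1 := congrArg Matrix.det hM
    rw [det_mul, det_mul, det_conjTranspose] at h1
    have h2 : (formMatrix n).det ≠ 0 := by
      intro h
      have := congrArg Matrix.det (formMatrix_mul_self (n := n))
      rw [det_mul, h, det_one, zero_mul] at this
      exact zero_ne_one this
    have h3 : star M.det * M.det = 1 := mul_right_cancel₀ h2 (by linear_combination h1)
    have h4 := congrArg norm h3
    rw [norm_mul, norm_star, norm_one] at h4
    nlinarith [norm_nonneg M.det]
  obtain ⟨l, hl⟩ := IsAlgClosed.exists_pow_nat_eq (M.det⁻¹) (n := n + 1) (Nat.succ_pos n)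
  have hln : ‖l‖ = 1 := by
    rw [← pow_eq_one_iff_of_nonneg (norm_nonneg l) (Nat.succ_ne_zero n), ← norm_pow, hl, norm_inv,
      hdet, inv_one]
  have hdet0 : M.det ≠ 0 := fun h => by simp [h] at hdet
  refine ⟨⟨l • M, ?_⟩, ?_, fun z => ?_⟩
  · rw [det_smul, Fintype.card_sum, Fintype.card_fin, Fintype.card_unit, hl,
      inv_mul_cancel₀ hdet0]
  · change (l • M)ᴴ * formMatrix n * (l • M) = formMatrix n
    rw [conjTranspose_smul, Matrix.smul_mul, Matrix.smul_mul, Matrix.mul_smul, smul_smul, hM,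
      Complex.star_def, Complex.conj_mul', hln]
    simp
  · obtain ⟨c, -, hc⟩ := hγ z
    exact ⟨l * c, by rw [Matrix.smul_mulVec, hc, smul_smul]⟩

/-- The vector `(z, 1)` for an arbitrary `z`. -/
def homogVec (z : Cn n) : Fin n ⊕ Unit → ℂ := Sum.elim (fun j => z j) fun _ => 1

/-- The denominator of the fractional linear map at z is the nonzero scalar c in `Moves`. -/
theorem Moves.isHolo {M : Matrix (Fin n ⊕ Unit) (Fin n ⊕ Unit) ℂ} {γ : Ball n → Ball n}
    (hM : Moves M γ) : IsHolo γ := by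
  refine ⟨fun z => WithLp.toLp 2 fun j =>
    (M *ᵥ homogVec z) (Sum.inl j) / (M *ᵥ homogVec z) (Sum.inr ()), ?_, fun z => ?_⟩
  · have hd : ∀ a, Differentiable ℂ fun z : Cn n => (M *ᵥ homogVec z) a := by
      intro a
      have : (fun z : Cn n => (M *ᵥ homogVec z) a) =
          fun z : Cn n => ∑ j, M a (Sum.inl j) * z j + M a (Sum.inr ()) := by
        funext z
        simp [mulVec, dotProduct, homogVec]
      rw [this]
      fun_prop
    refine (differentiableOn_euclidean).2 fun j => ?_
    simp only [div_eq_mul_inv]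
    refine (hd (Sum.inl j)).differentiableOn.fun_mul
      ((hd (Sum.inr ())).differentiableOn.fun_inv fun z hz => ?_)
    obtain ⟨c, hc0, hc⟩ := hM ⟨z, hz⟩
    have : (M *ᵥ homogVec z) (Sum.inr ()) = c :=
      (congrFun hc (Sum.inr ())).trans (mul_one c)
    rwa [this]
  · obtain ⟨c, hc0, hc⟩ := hM z
    change M *ᵥ homogVec z.1 = _ at hc
    ext j
    simp [hc, homog, hc0]

/-- The ball is homogeneous: some matrix that preserves the form moves a given point to the
origin. It is a reflection. -/
theorem exists_preservesForm_zero (a : Ball n) :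
    ∃ M : Matrix (Fin n ⊕ Unit) (Fin n ⊕ Unit) ℂ, PreservesForm M ∧
      ∃ c : ℂ, c ≠ 0 ∧ M *ᵥ homog a = c • homog ⟨0, Metric.mem_ball_self one_pos⟩ := by
  have ha : ‖a.1‖ ^ 2 < 1 := (sq_lt_one_iff₀ (norm_nonneg _)).2 (mem_ball_zero_iff.1 a.2)
  set s : ℝ := √(1 - ‖a.1‖ ^ 2) with hs
  have hs0 : 0 < s := Real.sqrt_pos.2 (by linarith)
  -- The form has the value -s² at both (a, 1) and (0, -s). The reflection in their difference v =
  -- (a, 1 + s) exchanges them; κ below is -2 / form(v, v).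
  have hs2 : s ^ 2 = 1 - ‖a.1‖ ^ 2 := Real.sq_sqrt (by linarith)
  have hsum : ∑ j, star (a.1 j) * a.1 j = 1 - (s : ℂ) ^ 2 := by
    rw [← Complex.ofReal_pow, hs2, EuclideanSpace.norm_sq_eq]
    simp [Complex.conj_mul']
  set v : Fin n ⊕ Unit → ℂ := Sum.elim (fun j => a.1 j) fun _ => ((1 + s : ℝ) : ℂ) with hv
  set κ : ℝ := (s * (1 + s))⁻¹ with hκ
  have hκ0 : (κ : ℂ) * (s * (1 + s)) = 1 := by
    rw [hκ]; norm_cast; field_simp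
  have hvv : form v v = -2 * (s * (1 + s)) := by
    simp only [form_eq, hv, Sum.elim_inl, Sum.elim_inr]
    rw [hsum, Complex.star_def, Complex.conj_ofReal]
    push_cast; ring
  have hva : form v (homog a) = -(s * (1 + s)) := by
    simp only [form_eq, hv, homog, Sum.elim_inl, Sum.elim_inr]
    rw [hsum, Complex.star_def, Complex.conj_ofReal]
    push_cast; ring
  set K := vecMulVec v (star v) with hK
  have hKH : Kᴴ = K := by rw [hK, conjTranspose_vecMulVec, star_star]
  have hKK : K * formMatrix n * K = form v v • K := by
    rw [hK, vecMulVec_mul, vecMulVec_mul_vecMulVec, ← dotProduct_mulVec, form, vecMulVec_smul]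
  refine ⟨1 + (κ : ℂ) • (K * formMatrix n), ?_, -s, by simpa using hs0.ne', ?_⟩
  · rw [PreservesForm, conjTranspose_add, conjTranspose_smul, conjTranspose_mul, hKH,
      formMatrix_conjTranspose, conjTranspose_one, Complex.star_def, Complex.conj_ofReal]
    have e : (1 + (κ : ℂ) • (formMatrix n * K)) * formMatrix n *
        (1 + (κ : ℂ) • (K * formMatrix n)) = formMatrix n +
        (2 * κ : ℂ) • (formMatrix n * K * formMatrix n) +
        ((κ : ℂ) * κ) • (formMatrix n * (K * formMatrix n * K) * formMatrix n) := by
      simp only [Matrix.add_mul, Matrix.mul_add, Matrix.one_mul, Matrix.mul_one, Matrix.smul_mul,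
        Matrix.mul_smul, smul_add, smul_smul, Matrix.mul_assoc, two_mul, add_smul]
      abel
    rw [e, hKK, hvv, Matrix.mul_smul, Matrix.smul_mul, smul_smul, add_assoc, ← add_smul]
    have : (2 * κ + κ * κ * (-2 * (s * (1 + s))) : ℂ) = 0 := by
      linear_combination (-2 * (κ : ℂ)) * hκ0
    rw [this, zero_smul, add_zero]
  · have : K *ᵥ (formMatrix n *ᵥ homog a) = form v (homog a) • v := by
      rw [hK, vecMulVec_mulVec, form]
      simp
    rw [add_mulVec, one_mulVec, smul_mulVec, ← mulVec_mulVec, this, hva, smul_smul]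
    have h1 : (κ : ℂ) * -(s * (1 + s)) = -1 := by linear_combination -hκ0
    rw [h1]
    ext (j | j)
    · simp [homog, hv]
    · simp [homog, hv]

/-! ### Extension of isometries for the Hermitian form -/

theorem form_add_left (x x' y : Fin n ⊕ Unit → ℂ) : form (x + x') y = form x y + form x' y := by
  simp only [form, star_add, add_dotProduct]

theorem form_add_right (x y y' : Fin n ⊕ Unit → ℂ) : form x (y + y') = form x y + form x y' := by
  simp only [form, mulVec_add, dotProduct_add]

theorem form_zero_left (y : Fin n ⊕ Unit → ℂ) : form 0 y = 0 := by simp [form]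

theorem form_zero_right (x : Fin n ⊕ Unit → ℂ) : form x 0 = 0 := by simp [form]

theorem eq_of_forall_form_eq {y y' : Fin n ⊕ Unit → ℂ} (h : ∀ x, form x y = form x y') :
    y = y' := by
  have h1 : formMatrix n *ᵥ y = formMatrix n *ᵥ y' := by
    ext a
    have := h (Pi.single a 1)
    rwa [form, form, ← Pi.single_star, star_one, single_one_dotProduct,
      single_one_dotProduct] at this
  have h2 := congrArg (formMatrix n *ᵥ ·) h1
  simpa only [mulVec_mulVec, formMatrix_mul_self, one_mulVec] using h2

theorem preservesForm_of_forall {M : Matrix (Fin n ⊕ Unit) (Fin n ⊕ Unit) ℂ}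
    (h : ∀ x y, form (M *ᵥ x) (M *ᵥ y) = form x y) : PreservesForm M := by
  refine Matrix.ext_of_mulVec_single fun a => ?_
  have key : ∀ x y : Fin n ⊕ Unit → ℂ, star x ⬝ᵥ ((Mᴴ * formMatrix n * M) *ᵥ y) =
      star x ⬝ᵥ (formMatrix n *ᵥ y) := fun x y => by
    have := h x y
    rwa [form, star_mulVec, ← dotProduct_mulVec, mulVec_mulVec, mulVec_mulVec, form] at this
  ext b
  have := key (Pi.single b 1) (Pi.single a 1)
  rwa [← Pi.single_star, star_one, single_one_dotProduct, single_one_dotProduct] at this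

theorem form_linearCombination {ι : Type*} {x y : ι → Fin n ⊕ Unit → ℂ}
    (h : ∀ i j, form (x i) (x j) = form (y i) (y j)) (p q : ι →₀ ℂ) :
    form (Finsupp.linearCombination ℂ x p) (Finsupp.linearCombination ℂ x q) =
      form (Finsupp.linearCombination ℂ y p) (Finsupp.linearCombination ℂ y q) := by
  induction p using Finsupp.induction_linear with
  | zero => simp [form_zero_left]
  | add p p' hp hp' => simp only [map_add, form_add_left, hp, hp']
  | single i c =>
    induction q using Finsupp.induction_linear with
    | zero => simp [form_zero_right]
    | add q q' hq hq' => simp only [map_add, form_add_right, hq, hq']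
    | single j d => simp only [Finsupp.linearCombination_single, form_smul_smul, h]

/-- Witt's theorem for a spanning family. -/
theorem exists_preservesForm_of_form_eq {ι : Type*} {x y : ι → Fin n ⊕ Unit → ℂ}
    (h : ∀ i j, form (x i) (x j) = form (y i) (y j))
    (hx : Submodule.span ℂ (Set.range x) = ⊤) :
    ∃ M : Matrix (Fin n ⊕ Unit) (Fin n ⊕ Unit) ℂ, PreservesForm M ∧ ∀ i, M *ᵥ x i = y i := by
  have hsurj : LinearMap.range (Finsupp.linearCombination ℂ x) = ⊤ := by
    rw [Finsupp.range_linearCombination, hx]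
  -- M is defined through a linear section, so one need not know beforehand that linear relations
  -- among the x i also hold among the y i.
  obtain ⟨s, hs⟩ := (Finsupp.linearCombination ℂ x).exists_rightInverse_of_surjective hsurj
  have hs' : ∀ v, Finsupp.linearCombination ℂ x (s v) = v := LinearMap.congr_fun hs
  set M := LinearMap.toMatrix' (Finsupp.linearCombination ℂ y ∘ₗ s) with hM
  have hMv : ∀ v, M *ᵥ v = Finsupp.linearCombination ℂ y (s v) := fun v => by
    rw [hM, ← Matrix.toLin'_apply, Matrix.toLin'_toMatrix']; rfl
  have hP : PreservesForm M := preservesForm_of_forall fun v w => by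
    rw [hMv, hMv, ← form_linearCombination h, hs', hs']
  -- The form is nondegenerate and M is onto, so it suffices to pair with the vectors M w.
  refine ⟨M, hP, fun i => eq_of_forall_form_eq fun v => ?_⟩
  obtain ⟨w, rfl⟩ : ∃ w, M *ᵥ w = v :=
    ⟨(formMatrix n * Mᴴ * formMatrix n) *ᵥ v, by rw [mulVec_mulVec, hP.right_inv, one_mulVec]⟩
  rw [hP.form_mulVec]
  have := form_linearCombination h (s w) (Finsupp.single i 1)
  simpa only [hs', Finsupp.linearCombination_single, one_smul, ← hMv] using this

/-- The points p with (p, 1) in a given linear subspace form an affine subspace, and the vectors (p,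
1) for all p in ℂⁿ span ℂⁿ × ℂ. -/
theorem span_homog_eq_top {V : Set (Ball n)}
    (hV : affineSpan ℂ ((fun z : Ball n => (z : Cn n)) '' V) = ⊤) :
    Submodule.span ℂ (Set.range fun z : V => homog z.1) = ⊤ := by
  set W := Submodule.span ℂ (Set.range fun z : V => homog z.1) with hW
  let A : AffineSubspace ℂ (Cn n) :=
    { carrier := {p | homogVec p ∈ W}
      smul_vsub_vadd_mem' := fun c p₁ p₂ p₃ h₁ h₂ h₃ => by
        have : homogVec (c • (p₁ -ᵥ p₂) +ᵥ p₃) =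
            c • (homogVec p₁ - homogVec p₂) + homogVec p₃ := by
          ext (j | j) <;> simp [homogVec]
        rw [Set.mem_ofPred_eq, this]
        exact W.add_mem (W.smul_mem c (W.sub_mem h₁ h₂)) h₃ }
  have hA : affineSpan ℂ ((fun z : Ball n => (z : Cn n)) '' V) ≤ A := by
    refine affineSpan_le.2 ?_
    rintro _ ⟨z, hz, rfl⟩
    exact Submodule.subset_span ⟨⟨z, hz⟩, rfl⟩
  rw [hV] at hA
  have hall : ∀ p, homogVec p ∈ W := fun p => hA (AffineSubspace.mem_top ℂ _ p)
  refine Submodule.eq_top_iff'.2 fun x => ?_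
  have : x = homogVec (WithLp.toLp 2 fun j => x (Sum.inl j)) +
      (x (Sum.inr ()) - 1) • homogVec 0 := by
    ext (j | j) <;> simp [homogVec]
  rw [this]
  exact W.add_mem (hall _) (W.smul_mem _ (hall _))

/-! ### Positive kernels -/

section Pick

open scoped ComplexOrder

/-- A positive semidefinite kernel. -/
def PosKernel {X : Type*} (K : X → X → ℂ) : Prop :=
  ∀ (m : ℕ) (z : Fin m → X), (Matrix.of fun i j => K (z i) (z j)).PosSemidef

theorem PosKernel.star_eq {X : Type*} {K : X → X → ℂ} (hK : PosKernel K) (z w : X) :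
    star (K z w) = K w z := by
  have := congrFun (congrFun (hK 2 ![z, w]).1 1) 0
  simpa using this

/-- The determinant of the 2 × 2 matrix at z, w is nonnegative. -/
theorem PosKernel.norm_sq_le {X : Type*} {K : X → X → ℂ} (hK : PosKernel K) (z w : X) :
    ‖K z w‖ ^ 2 ≤ (K z z).re * (K w w).re := by
  have h := (hK 2 ![z, w]).det_nonneg
  have hr : ∀ z, K z z = ((K z z).re : ℂ) := fun z =>
    (Complex.conj_eq_iff_re.1 (hK.star_eq z z)).symm
  rw [det_fin_two] at h
  simp only [of_apply, cons_val_zero, cons_val_one] at h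
  rw [← hK.star_eq z w, Complex.star_def, Complex.mul_conj', hr z, hr w] at h
  rw [← Complex.ofReal_mul, ← Complex.ofReal_pow, ← Complex.ofReal_sub, Complex.zero_le_real] at h
  linarith

/-- A positive kernel whose pointwise inverse is positive has rank one. -/
theorem PosKernel.rank_one {X : Type*} {K K' : X → X → ℂ} (hK : PosKernel K)
    (hK' : PosKernel K') (h : ∀ z w, K z w * K' z w = 1) (u z w : X) :
    K w w * K u z = K w z * K u w := by
  have hr : ∀ {L : X → X → ℂ}, PosKernel L → ∀ z, L z z = ((L z z).re : ℂ) := fun hL z =>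
    (Complex.conj_eq_iff_re.1 (hL.star_eq z z)).symm
  have hre : ∀ z, (K z z).re * (K' z z).re = 1 := fun z => by
    have := h z z
    rw [hr hK z, hr hK' z] at this
    exact_mod_cast this
  -- Cauchy–Schwarz for K and for its reciprocal give opposite inequalities.
  have heq : ‖K w z‖ ^ 2 = (K w w).re * (K z z).re := by
    refine le_antisymm (hK.norm_sq_le w z) ?_
    have h1 := hK'.norm_sq_le w z
    have h2 : ‖K w z‖ ^ 2 * ‖K' w z‖ ^ 2 = 1 := by
      rw [← mul_pow, ← norm_mul, h, norm_one, one_pow]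
    have h3 : ((K w w).re * (K z z).re) * ((K' w w).re * (K' z z).re) = 1 := by
      linear_combination (K z z).re * (K' z z).re * hre w + hre z
    have h4 : 0 ≤ (K w w).re * (K z z).re := (sq_nonneg _).trans (hK.norm_sq_le w z)
    have h5 : 0 ≤ ‖K w z‖ ^ 2 := sq_nonneg _
    nlinarith [mul_le_mul_of_nonneg_left h1 (mul_nonneg h4 h5)]
  have hps := hK 3 ![u, z, w]
  -- By `heq` the quadratic form vanishes at v. A positive semidefinite matrix then kills v, and the
  -- row of u is the claim.
  set v : Fin 3 → ℂ := ![0, K w w, -K w z] with hv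
  have hprod : K w z * K z w = K w w * K z z := by
    rw [← hK.star_eq w z, Complex.star_def, Complex.mul_conj', hr hK w, hr hK z]
    exact_mod_cast heq
  have hz := (hps.dotProduct_mulVec_zero_iff v).1 (by
    have s1 : star (K w w) = K w w := hK.star_eq w w
    have s2 : star (K w z) = K z w := hK.star_eq w z
    simp only [dotProduct, mulVec, Fin.sum_univ_three, hv, of_apply, Pi.star_apply]
    simp only [cons_val_zero, cons_val_one, cons_val, star_zero, star_neg, s1, s2]
    linear_combination (-K w w) * hprod)
  have h0 := congrFun hz 0
  simp only [dotProduct, mulVec, Fin.sum_univ_three, hv, of_apply] at h0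
  simp only [cons_val_zero, cons_val_one, cons_val, Pi.zero_apply] at h0
  linear_combination h0

/-! ### The kernel vectors -/

theorem adjoint_toOp_kernelVec (φ : FInf n) (z : Ball n) :
    ContinuousLinearMap.adjoint (toOp φ) (kernelVec z) = star (eval z φ) • kernelVec z := by
  refine ext_inner_right ℂ fun x => ?_
  rw [ContinuousLinearMap.adjoint_inner_left, inner_kernelVec_apply, inner_smul_left,
    Complex.star_def, Complex.conj_conj]
  rfl

theorem inner_vac_kernelVec (z : Ball n) : ⟪vac n, kernelVec z⟫_ℂ = 1 := by
  rw [vac, inner_basisVec]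
  simp [kernelVec, monomial]

/-- Apply ∑ S_j S_j^* = 1 - (projection onto the vacuum) to the eigenvector `kernelVec w`: this
yields the Drury–Arveson kernel 1 / (1 - ⟨w, z⟩). -/
theorem inner_kernelVec_kernelVec (z w : Ball n) :
    ⟪kernelVec z, kernelVec w⟫_ℂ * (1 - ⟪w.1, z.1⟫_ℂ) = 1 := by
  have h := congrArg (fun x => ⟪kernelVec z, x⟫_ℂ) (sum_creation_adjoint_creation (kernelVec w))
  have h1 : ∀ j, ContinuousLinearMap.adjoint (creation j) (kernelVec w) =
      star (w.1 j) • kernelVec w := fun j => by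
    rw [← eval_S]; exact adjoint_toOp_kernelVec (S j) w
  have h2 : ⟪kernelVec z, vac n⟫_ℂ = 1 := by
    rw [← inner_conj_symm, inner_vac_kernelVec, map_one]
  simp only [h1, map_smul, inner_sum, inner_smul_right, inner_kernelVec_creation, inner_sub_right,
    inner_vac_kernelVec, h2, mul_one] at h
  have h3 : ⟪w.1, z.1⟫_ℂ = ∑ j, star (w.1 j) * z.1 j := by
    simp [PiLp.inner_apply, mul_comm]
  simp only [← mul_assoc, ← Finset.sum_mul] at h
  rw [← h3] at h
  linear_combination -h

theorem inner_kernelVec_kernelVec_eq (z w : Ball n) :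
    ⟪kernelVec z, kernelVec w⟫_ℂ = -(form (homog w) (homog z))⁻¹ := by
  have h := inner_kernelVec_kernelVec z w
  rw [← inv_neg, form_homog, neg_sub]
  exact eq_inv_of_mul_eq_one_left h

/-! ### Row matrices -/

/-- The square matrix with a given row and zeros elsewhere. -/
def rowMat {R : Type*} [Zero R] (i₀ : Fin n) (a : Fin n → R) : Matrix (Fin n) (Fin n) R :=
  Matrix.of fun i j => if i = i₀ then a j else 0

theorem matOp_apply {k : ℕ} (A : Matrix (Fin k) (Fin k) (FInf n))
    (x : PiLp 2 fun _ : Fin k => Fock n) (i : Fin k) :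
    matOp A x i = ∑ j, toOp (A i j) (x j) := by
  simp [matOp]

theorem norm_matOp_rowMat_S_le (i₀ : Fin n) : ‖matOp (rowMat i₀ (S : Fin n → FInf n))‖ ≤ 1 := by
  refine ContinuousLinearMap.opNorm_le_bound _ zero_le_one fun x => ?_
  rw [one_mul]
  refine le_of_sq_le_sq (le_of_eq ?_) (norm_nonneg _)
  rw [PiLp.norm_sq_eq_of_L2, PiLp.norm_sq_eq_of_L2, Finset.sum_eq_single i₀]
  · rw [matOp_apply, ← norm_sum_creation_sq]
    simp [rowMat]
    rfl
  · intro i _ hi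
    rw [matOp_apply]
    simp [rowMat, hi, toOp]
  · simp

theorem quotMatNorm_le {Δ : Set (Ball n)} {k : ℕ} (A : Matrix (Fin k) (Fin k) (FInf n)) :
    quotMatNorm Δ (A.map (proj Δ)) ≤ ‖matOp A‖ :=
  csInf_le ⟨0, by rintro _ ⟨A, -, rfl⟩; exact norm_nonneg _⟩ ⟨A, rfl, rfl⟩

theorem exists_lift_map_proj {Δ : Set (Ball n)} {k : ℕ} (B : Matrix (Fin k) (Fin k) (QuotAlg Δ)) :
    ∃ A : Matrix (Fin k) (Fin k) (FInf n), A.map (proj Δ) = B := by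
  choose A hA using fun i j => proj_surjective (B i j)
  exact ⟨Matrix.of A, by ext i j; exact hA i j⟩

theorem exists_lift_of_quotMatNorm_lt {Δ : Set (Ball n)} {k : ℕ}
    {B : Matrix (Fin k) (Fin k) (QuotAlg Δ)} {r : ℝ} (h : quotMatNorm Δ B < r) :
    ∃ A : Matrix (Fin k) (Fin k) (FInf n), A.map (proj Δ) = B ∧ ‖matOp A‖ < r := by
  obtain ⟨A₀, hA₀⟩ := exists_lift_map_proj B
  obtain ⟨_, ⟨A, hA, rfl⟩, hr⟩ := exists_lt_of_csInf_lt
    (⟨_, A₀, hA₀, rfl⟩ : Set.Nonempty {r : ℝ | ∃ A : Matrix (Fin k) (Fin k) (FInf n),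
      A.map (proj Δ) = B ∧ r = ‖matOp A‖}) h
  exact ⟨A, hA, hr⟩

/-- An automorphism maps the row of the left creation operators to a row of norm at most one. -/
theorem exists_lift_row {Δ : Set (Ball n)} (i₀ : Fin n) (Φ : autGroup Δ) {r : ℝ} (hr : 1 < r) :
    ∃ A : Matrix (Fin n) (Fin n) (FInf n), ‖matOp A‖ < r ∧
      ∀ z : specClosure Δ, ∀ j, eval z.1 (A i₀ j) = (dualPt Φ z).1.1 j := by
  have h1 : quotMatNorm Δ ((rowMat i₀ (S : Fin n → FInf n)).map (proj Δ)) < r :=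
    ((quotMatNorm_le _).trans (norm_matOp_rowMat_S_le i₀)).trans_lt hr
  -- Complete isometry is used only here, for the n × n matrix whose one nonzero row is (S_1, …,
  -- S_n).
  rw [← (Φ⁻¹).2.2.2] at h1
  obtain ⟨A, hA, hAr⟩ := exists_lift_of_quotMatNorm_lt h1
  refine ⟨A, hAr, fun z j => ?_⟩
  have h2 : proj Δ (A i₀ j) = Φ.1.symm (proj Δ (S j)) := by
    have := congrFun (congrFun hA i₀) j
    simpa [rowMat] using this
  rw [← quotEval_proj, h2, quotEval_symm, quotEval_proj, eval_S]

/-- The i-th row of A has norm at most ‖A‖, hence so has its adjoint, the column x of adjoints at y: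
pair ‖x‖² = ⟨y, (A x)_i⟩ and cancel ‖x‖. -/
theorem sum_norm_sq_adjoint_le {k : ℕ} (A : Matrix (Fin k) (Fin k) (FInf n)) (i : Fin k)
    (y : Fock n) :
    ∑ j, ‖ContinuousLinearMap.adjoint (toOp (A i j)) y‖ ^ 2 ≤ ‖matOp A‖ ^ 2 * ‖y‖ ^ 2 := by
  set x : PiLp 2 fun _ : Fin k => Fock n :=
    WithLp.toLp 2 fun j => ContinuousLinearMap.adjoint (toOp (A i j)) y with hx
  have h1 : ‖x‖ ^ 2 = ∑ j, ‖ContinuousLinearMap.adjoint (toOp (A i j)) y‖ ^ 2 :=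
    PiLp.norm_sq_eq_of_L2 _ x
  rw [← h1]
  have h2 : ((‖x‖ ^ 2 : ℝ) : ℂ) = ⟪y, matOp A x i⟫_ℂ := by
    rw [h1, matOp_apply, inner_sum]
    push_cast
    refine Finset.sum_congr rfl fun j _ => ?_
    rw [norm_sq_eq_inner, ContinuousLinearMap.adjoint_inner_left]
  have h3 : ‖x‖ ^ 2 ≤ ‖y‖ * (‖matOp A‖ * ‖x‖) := by
    calc ‖x‖ ^ 2 = ‖((‖x‖ ^ 2 : ℝ) : ℂ)‖ := by
          rw [Complex.norm_real, Real.norm_of_nonneg (sq_nonneg _)]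
      _ ≤ ‖y‖ * ‖matOp A x i‖ := by rw [h2]; exact norm_inner_le_norm _ _
      _ ≤ ‖y‖ * ‖matOp A x‖ := by gcongr; exact PiLp.norm_apply_le _ _
      _ ≤ _ := by gcongr; exact (matOp A).le_opNorm x
  rcases (norm_nonneg x).eq_or_lt with h0 | h0
  · rw [← h0, zero_pow two_ne_zero]; positivity
  · have h4 : ‖x‖ ≤ ‖y‖ * ‖matOp A‖ := by nlinarith
    calc ‖x‖ ^ 2 ≤ (‖y‖ * ‖matOp A‖) ^ 2 := by gcongr
      _ = _ := by ring

theorem star_form (x y : Fin n ⊕ Unit → ℂ) : star (form x y) = form y x := by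
  simp [form_eq, mul_comm]

/-- The Pick kernel of the dual map is positive. -/
theorem posKernel_dualPt {Δ : Set (Ball n)} (i₀ : Fin n) (Φ : autGroup Δ) :
    PosKernel fun z w : specClosure Δ =>
      form (homog (dualPt Φ w).1) (homog (dualPt Φ z).1) / form (homog w.1) (homog z.1) := by
  intro m z
  set F : Fin m → Ball n := fun i => (dualPt Φ (z i)).1 with hF
  refine Matrix.PosSemidef.of_dotProduct_mulVec_nonneg ?_ fun c => ?_
  · ext i j
    rw [conjTranspose_apply, of_apply, of_apply, Complex.star_def, map_div₀, ← Complex.star_def,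
      star_form, star_form]
  set y : Fock n := ∑ i, c i • kernelVec (z i).1 with hy
  have key : ∀ r : ℝ, 1 < r → ∑ j, ‖∑ i, (c i * star ((F i).1 j)) • kernelVec (z i).1‖ ^ 2 ≤
      r ^ 2 * ‖y‖ ^ 2 := by
    intro r hr
    obtain ⟨A, hA, hAz⟩ := exists_lift_row i₀ Φ hr
    refine (le_of_eq ?_).trans ((sum_norm_sq_adjoint_le A i₀ y).trans (by gcongr))
    refine Finset.sum_congr rfl fun j _ => ?_
    simp only [hy, map_sum, map_smul, adjoint_toOp_kernelVec, hAz, smul_smul, hF]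
  -- The quotient norm is an infimum, so a lift is available only below each r > 1; let r tend to 1.
  have key1 : ∑ j, ‖∑ i, (c i * star ((F i).1 j)) • kernelVec (z i).1‖ ^ 2 ≤ ‖y‖ ^ 2 := by
    have ht : Filter.Tendsto (fun r : ℝ => r ^ 2 * ‖y‖ ^ 2) (nhdsWithin 1 (Set.Ioi 1))
        (nhds (1 ^ 2 * ‖y‖ ^ 2)) :=
      ((continuous_pow 2).mul continuous_const).continuousWithinAt
    rw [one_pow, one_mul] at ht
    exact ge_of_tendsto ht (Filter.eventually_of_mem self_mem_nhdsWithin key)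
  have expand : ∀ b : Fin m → ℂ, ((‖∑ i, b i • kernelVec (z i).1‖ ^ 2 : ℝ) : ℂ) =
      ∑ i, ∑ l, star (b i) * b l * -(form (homog (z l).1) (homog (z i).1))⁻¹ := by
    intro b
    push_cast
    rw [norm_sq_eq_inner, sum_inner]
    refine Finset.sum_congr rfl fun i _ => ?_
    rw [inner_sum]
    refine Finset.sum_congr rfl fun l _ => ?_
    rw [inner_smul_left, inner_smul_right, inner_kernelVec_kernelVec_eq, Complex.star_def]
    ring
  -- Expanded in Gram entries of the kernel vectors, the defect in `key1` is the quadratic form of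
  -- the Pick kernel.
  have hval : star c ⬝ᵥ (Matrix.of fun i j => form (homog (F j)) (homog (F i)) /
      form (homog (z j).1) (homog (z i).1)) *ᵥ c =
      ((‖y‖ ^ 2 - ∑ j, ‖∑ i, (c i * star ((F i).1 j)) • kernelVec (z i).1‖ ^ 2 : ℝ) : ℂ) := by
    have swap : ∀ f : Fin n → Fin m → Fin m → ℂ,
        ∑ j, ∑ i, ∑ l, f j i l = ∑ i, ∑ l, ∑ j, f j i l := fun f => by
      rw [Finset.sum_comm]
      exact Finset.sum_congr rfl fun i _ => Finset.sum_comm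
    rw [Complex.ofReal_sub, Complex.ofReal_sum, hy, expand]
    simp only [expand]
    rw [swap]
    simp only [← Finset.sum_sub_distrib, dotProduct, mulVec, Finset.mul_sum, of_apply]
    refine Finset.sum_congr rfl fun i _ => Finset.sum_congr rfl fun l _ => ?_
    have h1 : ∑ j, star (c i * star ((F i).1 j)) * (c l * star ((F l).1 j)) *
        -(form (homog (z l).1) (homog (z i).1))⁻¹ =
        star (c i) * c l * -(form (homog (z l).1) (homog (z i).1))⁻¹ *
          ∑ j, star ((F l).1 j) * (F i).1 j := by
      rw [Finset.mul_sum]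
      refine Finset.sum_congr rfl fun j _ => ?_
      rw [star_mul', star_star]
      ring
    have h2 : form (homog (F l)) (homog (F i)) = ∑ j, star ((F l).1 j) * (F i).1 j - 1 := by
      simp [form_eq, homog]
    rw [h1, h2, Pi.star_apply, div_eq_mul_inv]
    ring
  rw [hval, Complex.zero_le_real]
  linarith

/-- The dual map is the restriction of a transformation of the ball that preserves the form. -/
theorem exists_preservesForm_dualPt {Δ : Set (Ball n)} (i₀ : Fin n)
    (hspan : affineSpan ℂ ((fun z : Ball n => (z : Cn n)) '' specClosure Δ) = ⊤)
    (Φ : autGroup Δ) :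
    ∃ M : Matrix (Fin n ⊕ Unit) (Fin n ⊕ Unit) ℂ, PreservesForm M ∧
      ∀ z : specClosure Δ, ∃ c : ℂ, c ≠ 0 ∧ M *ᵥ homog z.1 = c • homog (dualPt Φ z).1 := by
  obtain ⟨o⟩ := (AffineSubspace.nonempty_of_affineSpan_eq_top ℂ _ _ hspan).of_image.to_subtype
  set K : specClosure Δ → specClosure Δ → ℂ := fun z w =>
    form (homog (dualPt Φ w).1) (homog (dualPt Φ z).1) / form (homog w.1) (homog z.1) with hK
  have hKpos : PosKernel K := posKernel_dualPt i₀ Φ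
  have hKpos' : PosKernel fun z w : specClosure Δ =>
      form (homog w.1) (homog z.1) / form (homog (dualPt Φ w).1) (homog (dualPt Φ z).1) := by
    intro m z
    -- At the image points, the Pick kernel of Φ⁻¹ is the reciprocal of that of Φ.
    have := posKernel_dualPt i₀ Φ⁻¹ m fun i => dualPt Φ (z i)
    simpa only [dualPt_inv_dualPt] using this
  have hmul : ∀ z w : specClosure Δ, K z w * (form (homog w.1) (homog z.1) /
      form (homog (dualPt Φ w).1) (homog (dualPt Φ z).1)) = 1 := fun z w => by
    have h1 := form_homog_ne_zero w.1 z.1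
    have h2 := form_homog_ne_zero (dualPt Φ w).1 (dualPt Φ z).1
    simp only [hK]
    field_simp
  have hrank := hKpos.rank_one hKpos' hmul
  have hK0 : ∀ z w, K z w ≠ 0 := fun z w h => by
    have := hmul z w
    rw [h, zero_mul] at this
    exact zero_ne_one this
  have hKo : K o o = ((K o o).re : ℂ) := (Complex.conj_eq_iff_re.1 (hKpos.star_eq o o)).symm
  have hKo0 : 0 < (K o o).re := by
    have h1 := hKpos.norm_sq_le o o
    have h2 : (K o o).re ≠ 0 := fun h => hK0 o o (by rw [hKo, h, Complex.ofReal_zero])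
    have h3 : 0 ≤ K o o := by
      have := (hKpos 1 ![o]).diag_nonneg (i := 0)
      simpa using this
    exact lt_of_le_of_ne (Complex.le_def.1 h3).1 h2.symm
  -- Rank one means K(w, z) = K(w, o) K(o, z) / s². The scalars s / K(z, o) therefore absorb the
  -- Pick kernel and turn (z, 1) ↦ (F z, 1) into an isometry for the form.
  set s : ℝ := √(K o o).re with hs
  have hs0 : (s : ℂ) ≠ 0 := by exact_mod_cast (Real.sqrt_pos.2 hKo0).ne'
  have hs2 : (s : ℂ) * s = K o o := by
    rw [hKo, ← Complex.ofReal_mul, hs, Real.mul_self_sqrt hKo0.le]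
  obtain ⟨M, hM, hMx⟩ := exists_preservesForm_of_form_eq
    (x := fun z : specClosure Δ => homog z.1)
    (y := fun z : specClosure Δ => ((s : ℂ) / K z o) • homog (dualPt Φ z).1)
    (fun z w => by
      have h1 := form_homog_ne_zero z.1 w.1
      have h2 := hrank w z o
      have h3 : K w z * form (homog z.1) (homog w.1) =
          form (homog (dualPt Φ z).1) (homog (dualPt Φ w).1) := by
        simp only [hK]
        field_simp
      have h4 := hK0 o z
      have h5 := hK0 w o
      rw [form_smul_smul, ← h3, Complex.star_def, map_div₀, Complex.conj_ofReal,
        ← Complex.star_def, hKpos.star_eq]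
      field_simp
      rw [← hs2] at h2
      clear_value K
      linear_combination -h2)
    (span_homog_eq_top hspan)
  exact ⟨M, hM, fun z => ⟨_, div_ne_zero hs0 (hK0 z o), hMx z⟩⟩

end Pick

/-! ### Biholomorphic maps of the ball -/

theorem IsHolo.comp {f g : Ball n → Ball n} (hf : IsHolo f) (hg : IsHolo g) : IsHolo (f ∘ g) := by
  obtain ⟨F, hF, hFf⟩ := hf
  obtain ⟨G, hG, hGg⟩ := hg
  refine ⟨F ∘ G, hF.comp hG fun z hz => ?_, fun z => ?_⟩
  · rw [hGg ⟨z, hz⟩]; exact (g ⟨z, hz⟩).2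
  · rw [Function.comp, hGg, hFf]; rfl

theorem IsBiholo.mul {γ δ : Equiv.Perm (Ball n)} (hγ : IsBiholo γ) (hδ : IsBiholo δ) :
    IsBiholo (γ * δ) :=
  ⟨hγ.1.comp hδ.1, hδ.2.comp hγ.2⟩

theorem IsBiholo.inv {γ : Equiv.Perm (Ball n)} (hγ : IsBiholo γ) : IsBiholo γ⁻¹ :=
  ⟨hγ.2, hγ.1⟩

/-- The origin as a point of the ball. -/
def origin (n : ℕ) : Ball n := ⟨0, Metric.mem_ball_self one_pos⟩

/-- The Schwarz lemma. -/
theorem IsHolo.norm_le {f : Ball n → Ball n} (hf : IsHolo f) (h0 : f (origin n) = origin n)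
    (z : Ball n) : ‖(f z).1‖ ≤ ‖z.1‖ := by
  obtain ⟨F, hF, hFf⟩ := hf
  rw [← hFf]
  refine Complex.norm_le_norm_of_mapsTo_ball hF (fun w hw => ?_) ?_ (mem_ball_zero_iff.1 z.2)
  · rw [hFf ⟨w, hw⟩]
    exact Metric.ball_subset_closedBall (f ⟨w, hw⟩).2
  · exact (hFf (origin n)).trans (congrArg Subtype.val h0)

theorem IsBiholo.norm_eq {γ : Equiv.Perm (Ball n)} (hγ : IsBiholo γ)
    (h0 : γ (origin n) = origin n) (z : Ball n) : ‖(γ z).1‖ = ‖z.1‖ := by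
  refine le_antisymm (hγ.1.norm_le h0 z) ?_
  have h1 : γ.symm (origin n) = origin n := by rw [Equiv.symm_apply_eq, h0]
  simpa using hγ.2.norm_le h1 (γ z)

/-- A biholomorphic map of the ball that fixes the origin is linear. -/
theorem IsBiholo.exists_linear {γ : Equiv.Perm (Ball n)} (hγ : IsBiholo γ)
    (h0 : γ (origin n) = origin n) : ∃ A : Cn n →L[ℂ] Cn n, ∀ z : Ball n, (γ z).1 = A z.1 := by
  obtain ⟨F, hF, hFf⟩ := hγ.1
  have hF0 : F 0 = 0 := (hFf (origin n)).trans (congrArg Subtype.val h0)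
  refine ⟨fderiv ℂ F 0, fun z => ?_⟩
  rcases eq_or_ne z.1 0 with hz | hz
  · have : z = origin n := Subtype.ext hz
    rw [this, h0]
    simp [origin]
  set r : ℝ := ‖z.1‖ with hr
  have hr0 : 0 < r := norm_pos_iff.2 hz
  have hr1 : r < 1 := mem_ball_zero_iff.1 z.2
  have hrC : (r : ℂ) ≠ 0 := by exact_mod_cast hr0.ne'
  set u : Cn n := (r : ℂ)⁻¹ • z.1 with hu
  have hun : ‖u‖ = 1 := by
    rw [hu, norm_smul, norm_inv, Complex.norm_real, Real.norm_of_nonneg hr0.le, ← hr,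
      inv_mul_cancel₀ hr0.ne']
  have hzu : (r : ℂ) • u = z.1 := by rw [hu, smul_smul, mul_inv_cancel₀ hrC, one_smul]
  have hmaps : ∀ ζ : ℂ, ζ ∈ Metric.ball (0 : ℂ) 1 → ζ • u ∈ Metric.ball (0 : Cn n) 1 := by
    intro ζ hζ
    rw [mem_ball_zero_iff] at hζ ⊢
    rwa [norm_smul, hun, mul_one]
  set f : ℂ → Cn n := fun ζ => F (ζ • u) with hf
  have hfd : DifferentiableOn ℂ f (Metric.ball 0 1) :=
    hF.comp (differentiable_id.smul_const u).differentiableOn hmaps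
  have hf0 : f 0 = 0 := by simp [hf, hF0]
  have hfn : ∀ ζ ∈ Metric.ball (0 : ℂ) 1, ‖f ζ‖ = ‖ζ‖ := by
    intro ζ hζ
    have := hγ.norm_eq h0 ⟨ζ • u, hmaps ζ hζ⟩
    rw [hf]
    simp only [hFf ⟨ζ • u, hmaps ζ hζ⟩, this, norm_smul, hun, mul_one]
  have hrb : (r : ℂ) ∈ Metric.ball (0 : ℂ) 1 := by
    rwa [mem_ball_zero_iff, Complex.norm_real, Real.norm_of_nonneg hr0.le]
  -- On the complex line through z equality holds in the Schwarz lemma. As the norm of ℂⁿ is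
  -- strictly convex, F is linear on that disc; its slope is then the derivative of F at 0 in the
  -- direction u.
  have haff := Complex.affine_of_mapsTo_ball_of_norm_dslope_eq_div (c := 0) (z₀ := r)
    (R₁ := 1) (R₂ := 1) hfd (fun ζ hζ => by
      rw [hf0, mem_closedBall_zero_iff, hfn ζ hζ]; exact (mem_ball_zero_iff.1 hζ).le) hrb (by
      rw [dslope_of_ne _ hrC, slope_def_module, hf0, sub_zero, sub_zero, norm_smul, hfn _ hrb,
        norm_inv, inv_mul_cancel₀ (norm_ne_zero_iff.2 hrC), div_one])
  have hder : HasDerivAt f (fderiv ℂ F 0 u) 0 := by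
    have h1 : HasFDerivAt F (fderiv ℂ F 0) ((0 : ℂ) • u) := by
      rw [zero_smul]
      exact (hF.differentiableAt (Metric.ball_mem_nhds _ one_pos)).hasFDerivAt
    have h2 : HasDerivAt (fun ζ : ℂ => ζ • u) u 0 := by
      simpa using (hasDerivAt_id (0 : ℂ)).smul_const u
    exact h1.comp_hasDerivAt (0 : ℂ) h2
  set C := dslope f 0 r
  have hC : ∀ ζ ∈ Metric.ball (0 : ℂ) 1, f ζ = ζ • C := fun ζ hζ => by
    have := haff hζ
    simpa [hf0] using this
  have hder' : HasDerivAt f C 0 := by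
    have h2 : HasDerivAt (fun ζ : ℂ => ζ • C) C 0 := by
      simpa using (hasDerivAt_id (0 : ℂ)).smul_const C
    refine h2.congr_of_eventuallyEq ?_
    filter_upwards [Metric.ball_mem_nhds (0 : ℂ) one_pos] with ζ hζ using hC ζ hζ
  rw [← hFf, ← hzu, map_smul, hder.unique hder', ← hC _ hrb]

/-- A biholomorphic map of the ball that fixes an affinely spanning set is the identity. -/
theorem IsBiholo.eq_one {V : Set (Ball n)}
    (hV : affineSpan ℂ ((fun z : Ball n => (z : Cn n)) '' V) = ⊤) {γ : Equiv.Perm (Ball n)}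
    (hγ : IsBiholo γ) (hfix : ∀ z ∈ V, γ z = z) : γ = 1 := by
  obtain ⟨o, ho⟩ := (AffineSubspace.nonempty_of_affineSpan_eq_top ℂ _ _ hV).of_image
  obtain ⟨M, hM, c₀, hc₀, hMo⟩ := exists_preservesForm_zero o
  obtain ⟨μ, hμ, hμ'⟩ := hM.exists_perm
  have hμb : IsBiholo μ := ⟨hμ.isHolo, hμ'.isHolo⟩
  have hμo : μ o = origin n := by
    obtain ⟨c, hc, h⟩ := hμ o
    rw [hMo] at h
    exact (homog_smul_injective hc₀ h).symm
  -- The conjugate fixes the origin, so it is linear.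
  have hδ : IsBiholo (μ * γ * μ⁻¹) := (hμb.mul hγ).mul hμb.inv
  have hδμ : ∀ z, (μ * γ * μ⁻¹) (μ z) = μ (γ z) := fun z => by
    simp [Equiv.Perm.mul_apply]
  obtain ⟨A, hA⟩ := hδ.exists_linear (by rw [← hμo, hδμ, hfix o ho])
  -- This is μ before normalisation, linear in homogeneous coordinates. Thus A ∘ B = B needs
  -- checking only on the spanning vectors (z, 1), z ∈ V.
  let B : (Fin n ⊕ Unit → ℂ) →ₗ[ℂ] Cn n :=
    { toFun := fun x => WithLp.toLp 2 fun j => (M *ᵥ x) (Sum.inl j)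
      map_add' := fun x y => by ext j; simp [mulVec_add]
      map_smul' := fun c x => by ext j; simp [mulVec_smul] }
  have hB : ∀ z : Ball n, ∃ c : ℂ, c ≠ 0 ∧ B (homog z) = c • (μ z).1 := by
    intro z
    obtain ⟨c, hc, h⟩ := hμ z
    refine ⟨c, hc, ?_⟩
    ext j
    have := congrFun h (Sum.inl j)
    simpa [homog, B] using this
  have hAB : A.toLinearMap ∘ₗ B = B := by
    refine LinearMap.ext_on_range (span_homog_eq_top hV) fun z => ?_
    obtain ⟨c, -, h⟩ := hB z.1
    have h1 := hA (μ z.1)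
    rw [hδμ, hfix z.1 z.2] at h1
    change A (B (homog z.1)) = B (homog z.1)
    rw [h, map_smul, ← h1]
  have hall : ∀ z, γ z = z := fun z => by
    apply μ.injective
    apply Subtype.ext
    obtain ⟨c, hc, h⟩ := hB z
    have h1 := LinearMap.congr_fun hAB (homog z)
    change A (B (homog z)) = B (homog z) at h1
    rw [h, map_smul] at h1
    rw [← hδμ, hA]
    exact smul_right_injective _ hc h1
  exact Equiv.ext hall

/-! ### Affine combinations of the left creation operators -/

theorem sum_homog {E : Type*} [AddCommMonoid E] (f : Fin n ⊕ Unit → E) :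
    ∑ p, f p = ∑ j, f (Sum.inl j) + f (Sum.inr ()) := by
  simp

/-- The left creation operators together with the identity. -/
def gen : Fin n ⊕ Unit → Fock n →L[ℂ] Fock n := Sum.elim creation fun _ => 1

/-- The operator `∑ c_j S_j + c_0` that is attached to a vector `c` of homogeneous coordinates. -/
def linOp (c : Fin n ⊕ Unit → ℂ) : Fock n →L[ℂ] Fock n := ∑ p, c p • gen p

theorem linOp_eq (c : Fin n ⊕ Unit → ℂ) :
    linOp c = rowOp (fun j => c (Sum.inl j)) + c (Sum.inr ()) • 1 := by
  simp [linOp, gen, rowOp]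

theorem linOp_apply (c : Fin n ⊕ Unit → ℂ) (x : Fock n) : linOp c x = ∑ p, c p • gen p x := by
  simp [linOp]

theorem adjoint_linOp_apply (c : Fin n ⊕ Unit → ℂ) (x : Fock n) :
    ContinuousLinearMap.adjoint (linOp c) x =
      ∑ p, star (c p) • ContinuousLinearMap.adjoint (gen p) x := by
  simp only [linOp, map_sum, map_smulₛₗ, _root_.sum_apply, _root_.smul_apply,
    Complex.star_def]

theorem adjoint_gen_inr : ContinuousLinearMap.adjoint (gen (Sum.inr ()) : Fock n →L[ℂ] Fock n) =
    1 := by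
  simp [gen, ← ContinuousLinearMap.star_eq_adjoint]

/-- The linear combination of affine combinations given by a matrix identity. -/
theorem sum_smul_linOp (N M : Matrix (Fin n ⊕ Unit) (Fin n ⊕ Unit) ℂ) (h : N * M = 1)
    (p : Fin n ⊕ Unit) : ∑ a, N p a • linOp (M a) = gen p := by
  simp only [linOp, Finset.smul_sum, smul_smul]
  rw [Finset.sum_comm]
  simp only [← Finset.sum_smul, ← mul_apply, h, one_apply]
  simp

/-- The diagonal of the form matrix. -/
def sgn : Fin n ⊕ Unit → ℂ := Sum.elim (fun _ => 1) fun _ => -1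

theorem PreservesForm.sum_conj_mul {M : Matrix (Fin n ⊕ Unit) (Fin n ⊕ Unit) ℂ}
    (hM : PreservesForm M) (p q : Fin n ⊕ Unit) :
    ∑ a, star (M a q) * sgn a * M a p = if q = p then sgn q else 0 := by
  have := congrFun (congrFun hM q) p
  rw [formMatrix, mul_apply, diagonal_apply] at this
  simp only [mul_diagonal, conjTranspose_apply] at this
  exact this

theorem PreservesForm.sum_mul_conj {M : Matrix (Fin n ⊕ Unit) (Fin n ⊕ Unit) ℂ}
    (hM : PreservesForm M) (a b : Fin n ⊕ Unit) :
    ∑ p, M a p * sgn p * star (M b p) = if a = b then sgn a else 0 := by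
  have := congrFun (congrFun hM.mul_form_mul a) b
  rw [formMatrix, mul_apply, diagonal_apply] at this
  simp only [mul_diagonal, conjTranspose_apply] at this
  exact this

theorem sum_sgn_gen (x : Fock n) :
    ∑ p, sgn p • gen p (ContinuousLinearMap.adjoint (gen p) x) = -(⟪vac n, x⟫_ℂ • vac n) := by
  rw [sum_homog]
  have h : ∀ j : Fin n, sgn (Sum.inl j) • (gen (Sum.inl j) : Fock n →L[ℂ] Fock n)
      (ContinuousLinearMap.adjoint (gen (Sum.inl j)) x) =
      creation j (ContinuousLinearMap.adjoint (creation j) x) := fun j => by simp [sgn, gen]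
  simp only [h, sum_creation_adjoint_creation]
  rw [adjoint_gen_inr]
  simp only [sgn, gen, Sum.elim_inr, neg_smul, one_smul, one_apply_eq_self]
  abel

/-- The indefinite sum ∑ S_j S_j^* - 1 is unchanged when (S_1, …, S_n, 1) is transformed by a matrix
preserving the form. -/
theorem PreservesForm.sum_sgn_linOp {M : Matrix (Fin n ⊕ Unit) (Fin n ⊕ Unit) ℂ}
    (hM : PreservesForm M) (x : Fock n) :
    ∑ a, sgn a • linOp (M a) (ContinuousLinearMap.adjoint (linOp (M a)) x) =
      -(⟪vac n, x⟫_ℂ • vac n) := by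
  rw [← sum_sgn_gen]
  have h1 : ∀ a, sgn a • linOp (M a) (ContinuousLinearMap.adjoint (linOp (M a)) x) =
      ∑ p, ∑ q, (star (M a q) * sgn a * M a p) •
        gen p (ContinuousLinearMap.adjoint (gen q) x) := fun a => by
    rw [linOp_apply, Finset.smul_sum]
    refine Finset.sum_congr rfl fun p _ => ?_
    rw [adjoint_linOp_apply, map_sum, Finset.smul_sum, Finset.smul_sum]
    refine Finset.sum_congr rfl fun q _ => ?_
    rw [map_smul, smul_smul, smul_smul]
    congr 1
    ring
  simp only [h1]
  rw [Finset.sum_comm]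
  refine Finset.sum_congr rfl fun p _ => ?_
  rw [Finset.sum_comm]
  simp only [← Finset.sum_smul, hM.sum_conj_mul]
  simp

theorem PreservesForm.sum_linOp_adjoint {M : Matrix (Fin n ⊕ Unit) (Fin n ⊕ Unit) ℂ}
    (hM : PreservesForm M) (x : Fock n) :
    ∑ j, linOp (M (Sum.inl j)) (ContinuousLinearMap.adjoint (linOp (M (Sum.inl j))) x) =
      linOp (M (Sum.inr ())) (ContinuousLinearMap.adjoint (linOp (M (Sum.inr ()))) x) -
        ⟪vac n, x⟫_ℂ • vac n := by
  have h := hM.sum_sgn_linOp x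
  rw [sum_homog] at h
  simp only [sgn, Sum.elim_inl, Sum.elim_inr, one_smul, neg_smul] at h
  rw [sub_eq_add_neg, ← h]
  simp

/-- Collecting coefficients gives ∑ S_i y_i + y_0 = 0, so the indefinite norm ∑ ‖y_i‖² - ‖y_0‖² is
zero. Since M preserves the form, that norm equals ∑ ‖u_j‖². -/
theorem PreservesForm.eq_zero_of_sum_linOp_eq_zero
    {M : Matrix (Fin n ⊕ Unit) (Fin n ⊕ Unit) ℂ} (hM : PreservesForm M) {u : Fin n → Fock n}
    (hu : ∑ j, linOp (M (Sum.inl j)) (u j) = 0) (j : Fin n) : u j = 0 := by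
  set y : Fin n ⊕ Unit → Fock n := fun p => ∑ j, M (Sum.inl j) p • u j with hy
  have h1 : ∑ p, gen p (y p) = 0 := by
    rw [← hu]
    simp only [hy, map_sum, map_smul, linOp_apply]
    exact Finset.sum_comm
  have h2 : ∑ i, ‖y (Sum.inl i)‖ ^ 2 = ‖y (Sum.inr ())‖ ^ 2 := by
    rw [sum_homog] at h1
    simp only [gen, Sum.elim_inl, Sum.elim_inr] at h1
    rw [← norm_sum_creation_sq, eq_neg_of_add_eq_zero_left h1, norm_neg]
    rfl
  have h3 : ∑ p, sgn p * ⟪y p, y p⟫_ℂ = ∑ j, ⟪u j, u j⟫_ℂ := by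
    have e : ∀ p, sgn p * ⟪y p, y p⟫_ℂ = ∑ j, ∑ k,
        (M (Sum.inl k) p * sgn p * star (M (Sum.inl j) p)) * ⟪u j, u k⟫_ℂ := fun p => by
      simp only [hy, sum_inner, inner_sum, inner_smul_left, inner_smul_right, Finset.mul_sum,
        Complex.star_def]
      refine Finset.sum_comm.trans (Finset.sum_congr rfl fun j _ =>
        Finset.sum_congr rfl fun k _ => ?_)
      ring
    simp only [e]
    rw [Finset.sum_comm]
    refine Finset.sum_congr rfl fun j _ => ?_
    rw [Finset.sum_comm]
    simp only [← Finset.sum_mul, hM.sum_mul_conj]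
    simp [sgn]
  have h4 : ∑ j, ‖u j‖ ^ 2 = 0 := by
    rw [sum_homog] at h3
    simp only [sgn, Sum.elim_inl, Sum.elim_inr, one_mul, neg_mul, ← norm_sq_eq_inner] at h3
    have : (∑ i, ‖y (Sum.inl i)‖ ^ 2 - ‖y (Sum.inr ())‖ ^ 2 : ℝ) = ∑ j, ‖u j‖ ^ 2 := by
      rw [sub_eq_add_neg]
      exact_mod_cast h3
    rw [← this, h2, sub_self]
  have := (Finset.sum_eq_zero_iff_of_nonneg fun i _ => sq_nonneg ‖u i‖).1 h4 j (Finset.mem_univ j)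
  simpa using this

/-! ### Inverses in closed subalgebras -/

/-- The Neumann series for a⁻¹ stays in the closed subalgebra. -/
theorem exists_inverse_mem {A : Type*} [NormedRing A] [NormedAlgebra ℂ A] [CompleteSpace A]
    (B : Subalgebra ℂ A) (hB : IsClosed (B : Set A)) {a : A} (ha : a ∈ B) {d : ℂ} (hd : d ≠ 0)
    (h : ‖a - d • 1‖ < ‖d‖) : ∃ r ∈ B, r * a = 1 ∧ a * r = 1 := by
  set x : A := 1 - d⁻¹ • a with hx
  have hxn : ‖x‖ < 1 := by
    have : x = -(d⁻¹ • (a - d • 1)) := by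
      rw [smul_sub, smul_smul, inv_mul_cancel₀ hd, one_smul, neg_sub]
    rw [this, norm_neg, norm_smul, norm_inv, inv_mul_lt_one₀ (norm_pos_iff.2 hd)]
    exact h
  have hxB : x ∈ B := sub_mem (one_mem B) (B.smul_mem ha _)
  have ha' : a = d • (1 - x) := by
    rw [hx, sub_sub_cancel, smul_smul, mul_inv_cancel₀ hd, one_smul]
  refine ⟨d⁻¹ • ∑' k : ℕ, x ^ k, B.smul_mem ?_ _, ?_, ?_⟩
  · exact hB.mem_of_tendsto (summable_geometric_of_norm_lt_one hxn).hasSum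
      (Filter.Eventually.of_forall fun s => sum_mem fun k _ => pow_mem hxB k)
  · rw [ha', smul_mul_smul_comm, geom_series_mul_neg x hxn, inv_mul_cancel₀ hd, one_smul]
  · rw [ha', smul_mul_smul_comm, mul_neg_geom_series x hxn, mul_inv_cancel₀ hd, one_smul]

/-- The operators that leave a subspace invariant. -/
def invariantOps (W : Submodule ℂ (Fock n)) : Subalgebra ℂ (Fock n →L[ℂ] Fock n) where
  carrier := {A | ∀ x ∈ W, A x ∈ W}
  mul_mem' hA hB x hx := hA _ (hB x hx)
  add_mem' hA hB x hx := W.add_mem (hA x hx) (hB x hx)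
  algebraMap_mem' c x hx := by
    rw [Algebra.algebraMap_eq_smul_one]
    exact W.smul_mem c hx

theorem isClosed_invariantOps {W : Submodule ℂ (Fock n)} (hW : IsClosed (W : Set (Fock n))) :
    IsClosed (invariantOps W : Set (Fock n →L[ℂ] Fock n)) := by
  have : (invariantOps W : Set (Fock n →L[ℂ] Fock n)) = ⋂ x ∈ W, {A | A x ∈ W} := by
    ext A; simp [invariantOps]
  rw [this]
  exact isClosed_biInter fun x _ =>
    hW.preimage (ContinuousLinearMap.apply ℂ (Fock n) x).continuous

/-- The bounded operators that belong to the noncommutative Hardy algebra. -/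
def hardyOps (n : ℕ) : Subalgebra ℂ (Fock n →L[ℂ] Fock n) :=
  (hardyAlg n).comap (ContinuousLinearMapWOT.algEquiv (E := Fock n) ℂ).symm.toAlgHom

theorem isClosed_hardyOps : IsClosed (hardyOps n : Set (Fock n →L[ℂ] Fock n)) :=
  (Subalgebra.isClosed_topologicalClosure _).preimage ContinuousLinearMapWOT.continuous_ofCLM

theorem creation_mem_hardyOps (j : Fin n) : creation j ∈ hardyOps n := (S j).2

theorem gen_mem_hardyOps (p : Fin n ⊕ Unit) : gen p ∈ hardyOps n := by
  rcases p with j | _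
  · exact creation_mem_hardyOps j
  · exact one_mem _

theorem linOp_mem_hardyOps (c : Fin n ⊕ Unit → ℂ) : linOp c ∈ hardyOps n :=
  sum_mem fun p _ => Subalgebra.smul_mem _ (gen_mem_hardyOps p) _

/-! ### Row isometries with one-dimensional wandering space -/

theorem clm_ext_basisVec {A B : Fock n →L[ℂ] Fock n}
    (h : ∀ w, A (basisVec w) = B (basisVec w)) : A = B := by
  ext1 x
  have hA := (hasSum_basisVec x).mapL A
  have hB := (hasSum_basisVec x).mapL B
  simp only [map_smul, h] at hA hB
  exact hA.unique hB

theorem eq_top_of_basisVec_mem {W : Submodule ℂ (Fock n)} (hW : IsClosed (W : Set (Fock n)))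
    (h : ∀ w, basisVec w ∈ W) : W = ⊤ :=
  Submodule.eq_top_iff'.2 fun x => hW.mem_of_tendsto (hasSum_basisVec x)
    (Filter.Eventually.of_forall fun _ => W.sum_mem fun w _ => W.smul_mem _ (h w))

/-- The vector `T_{i₁} ⋯ T_{iₘ} g`. -/
def wordVec (T : Fin n → Fock n →L[ℂ] Fock n) (g : Fock n) (w : List (Fin n)) : Fock n :=
  w.foldr (fun j x => T j x) g

theorem orthonormal_wordVec {T : Fin n → Fock n →L[ℂ] Fock n} {g : Fock n} (hg : ‖g‖ = 1)
    (hT : ∀ i j x y, ⟪T i x, T j y⟫_ℂ = if i = j then ⟪x, y⟫_ℂ else 0)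
    (hTg : ∀ j x, ⟪g, T j x⟫_ℂ = 0) : Orthonormal ℂ (wordVec T g) := by
  rw [orthonormal_iff_ite]
  intro v
  induction v with
  | nil =>
    intro w
    cases w with
    | nil => simp [wordVec, hg]
    | cons j w => exact (hTg j _).trans (by simp)
  | cons i v ih =>
    intro w
    cases w with
    | nil =>
      rw [← inner_conj_symm]
      refine (congrArg _ (hTg i _)).trans (by simp)
    | cons j w =>
      refine (hT i j _ _).trans ?_
      by_cases hij : i = j
      · subst hij
        rw [if_pos rfl]
        refine (ih w).trans ?_
        simp
      · simp [hij]

/-- The vectors T_{i₁} ⋯ T_{iₘ} g are orthonormal, so basis vectors can be sent to them; this is the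
Fock part of the Wold decomposition of T. -/
theorem exists_linearIsometry {T : Fin n → Fock n →L[ℂ] Fock n} {g : Fock n} (hg : ‖g‖ = 1)
    (hT : ∀ i j x y, ⟪T i x, T j y⟫_ℂ = if i = j then ⟪x, y⟫_ℂ else 0)
    (hTg : ∀ j x, ⟪g, T j x⟫_ℂ = 0) :
    ∃ U : Fock n →ₗᵢ[ℂ] Fock n, U (vac n) = g ∧ ∀ j x, U (creation j x) = T j (U x) := by
  set U := (orthonormal_wordVec hg hT hTg).orthogonalFamily.linearIsometry with hU
  have hUw : ∀ w, U (basisVec w) = wordVec T g w := fun w => by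
    change U (lp.single 2 w (1 : ℂ)) = _
    rw [hU, OrthogonalFamily.linearIsometry_apply_single]
    simp
  refine ⟨U, hUw [], fun j x => ?_⟩
  have : U.toContinuousLinearMap ∘L creation j = T j ∘L U.toContinuousLinearMap := by
    refine clm_ext_basisVec fun w => ?_
    change U (creation j (basisVec w)) = T j (U (basisVec w))
    rw [creation_basisVec, hUw, hUw]
    rfl
  exact DFunLike.congr_fun this x

/-! ### The unitary operators that implement the transformations of the ball -/

theorem norm_linOp_sub_lt {c : Fin n ⊕ Unit → ℂ}
    (h : ∑ j, ‖c (Sum.inl j)‖ ^ 2 < ‖c (Sum.inr ())‖ ^ 2) :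
    ‖linOp c - c (Sum.inr ()) • 1‖ < ‖c (Sum.inr ())‖ := by
  rw [linOp_eq, add_sub_cancel_right]
  have h0 : 0 ≤ ∑ j, ‖c (Sum.inl j)‖ ^ 2 := Finset.sum_nonneg fun _ _ => sq_nonneg _
  refine lt_of_le_of_lt (ContinuousLinearMap.opNorm_le_bound _
    (Real.sqrt_nonneg (∑ j, ‖c (Sum.inl j)‖ ^ 2)) fun x => ?_) ((Real.sqrt_lt' ?_).2 h)
  · refine le_of_sq_le_sq (le_of_eq ?_) (by positivity)
    rw [norm_rowOp_apply, mul_pow, Real.sq_sqrt h0]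
  · exact norm_pos_iff.2 fun h1 => by
      rw [h1, norm_zero, zero_pow two_ne_zero] at h
      exact absurd h h0.not_gt

theorem PreservesForm.sum_norm_sq_row {M : Matrix (Fin n ⊕ Unit) (Fin n ⊕ Unit) ℂ}
    (hM : PreservesForm M) :
    ∑ j, ‖M (Sum.inr ()) (Sum.inl j)‖ ^ 2 = ‖M (Sum.inr ()) (Sum.inr ())‖ ^ 2 - 1 := by
  have h := hM.sum_mul_conj (Sum.inr ()) (Sum.inr ())
  rw [sum_homog] at h
  simp only [sgn, Sum.elim_inl, Sum.elim_inr, mul_one, if_true, Complex.star_def,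
    Complex.mul_conj', mul_neg, neg_mul] at h
  have h' : ∑ j, ‖M (Sum.inr ()) (Sum.inl j)‖ ^ 2 + -‖M (Sum.inr ()) (Sum.inr ())‖ ^ 2 = -1 := by
    exact_mod_cast h
  linarith

/-- The row `L₀⁻¹ (L₁, …, Lₙ)` attached to a matrix that preserves the form is implemented by a
unitary operator. -/
theorem PreservesForm.exists_unitary {M : Matrix (Fin n ⊕ Unit) (Fin n ⊕ Unit) ℂ}
    (hM : PreservesForm M) :
    ∃ (U : Fock n ≃ₗᵢ[ℂ] Fock n) (T : Fin n → Fock n →L[ℂ] Fock n),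
      (∀ j, T j ∈ hardyOps n) ∧ (∀ j, linOp (M (Sum.inr ())) * T j = linOp (M (Sum.inl j))) ∧
      ∀ j x, U (creation j x) = T j (U x) := by
  set L₀ := linOp (M (Sum.inr ())) with hL₀
  set d := M (Sum.inr ()) (Sum.inr ()) with hd
  have hrow := hM.sum_norm_sq_row
  have hlt : ∑ j, ‖M (Sum.inr ()) (Sum.inl j)‖ ^ 2 < ‖d‖ ^ 2 := by linarith
  have hd0 : d ≠ 0 := fun h => by
    have h0 : 0 ≤ ∑ j, ‖M (Sum.inr ()) (Sum.inl j)‖ ^ 2 :=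
      Finset.sum_nonneg fun _ _ => sq_nonneg _
    rw [h, norm_zero, zero_pow two_ne_zero] at hlt
    exact absurd hlt h0.not_gt
  -- The constant term d of L₀ dominates its linear part, whose squared norm is |d|² - 1.
  obtain ⟨R, hR, hRL, hLR⟩ := exists_inverse_mem (hardyOps n) isClosed_hardyOps
    (linOp_mem_hardyOps (M (Sum.inr ()))) hd0 (norm_linOp_sub_lt hlt)
  rw [← hL₀] at hRL hLR
  have hLR' : ∀ x, L₀ (R x) = x := DFunLike.congr_fun hLR
  have hRL' : ∀ x, R (L₀ x) = x := DFunLike.congr_fun hRL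
  set T : Fin n → Fock n →L[ℂ] Fock n := fun j => R * linOp (M (Sum.inl j)) with hT
  have hLT : ∀ j, L₀ * T j = linOp (M (Sum.inl j)) := fun j => by
    rw [hT, ← mul_assoc, hLR, one_mul]
  set g := R (vac n) with hg
  -- the defect operator
  have hadjR : ∀ x, ContinuousLinearMap.adjoint L₀ (ContinuousLinearMap.adjoint R x) = x := by
    intro x
    refine ext_inner_right ℂ fun y => ?_
    rw [ContinuousLinearMap.adjoint_inner_left, ContinuousLinearMap.adjoint_inner_left, hRL']
  -- Compress ∑ L_j L_j^* = L₀ L₀^* - (vacuum projection) by R on the left and R^* on the right.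
  have hdef : ∀ x, ∑ j, T j (ContinuousLinearMap.adjoint (T j) x) = x - ⟪g, x⟫_ℂ • g := by
    intro x
    have h1 : ∀ j, T j (ContinuousLinearMap.adjoint (T j) x) = R (linOp (M (Sum.inl j))
        (ContinuousLinearMap.adjoint (linOp (M (Sum.inl j)))
          (ContinuousLinearMap.adjoint R x))) := fun j => by
      have : ContinuousLinearMap.adjoint (T j) =
          ContinuousLinearMap.adjoint (linOp (M (Sum.inl j))) ∘L ContinuousLinearMap.adjoint R :=
        ContinuousLinearMap.adjoint_comp _ _
      rw [this]
      rfl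
    simp only [h1]
    rw [← map_sum, hM.sum_linOp_adjoint, ← hL₀, hadjR, map_sub, hRL', map_smul,
      ContinuousLinearMap.adjoint_inner_right]
  -- the wandering vector
  have hgn : ‖g‖ = 1 := by
    -- With V the linear part of L₀, V g = 1 - d g is orthogonal to the vacuum and ‖V g‖² = (|d|² -
    -- 1) ‖g‖². Expanding ‖1 - d g‖² and comparing gives ‖g‖ = 1.
    have h1 : L₀ g = vac n := hLR' _
    rw [hL₀, linOp_eq] at h1
    change rowOp _ g + d • g = vac n at h1
    set V := rowOp (fun j => M (Sum.inr ()) (Sum.inl j)) with hV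
    have h2 : ‖V g‖ ^ 2 = (‖d‖ ^ 2 - 1) * ‖g‖ ^ 2 := by rw [norm_rowOp_apply, hrow]
    have h3 : ⟪vac n, V g⟫_ℂ = 0 := by
      rw [hV, rowOp_apply, inner_sum]
      simp [inner_smul_right, inner_vac_creation]
    have h4 : V g = vac n - d • g := eq_sub_of_add_eq h1
    have h5 : ⟪vac n, d • g⟫_ℂ = 1 := by
      have : d • g = vac n - V g := by rw [h4, sub_sub_cancel]
      rw [this, inner_sub_right, h3, sub_zero, ← norm_sq_eq_inner, norm_vac]
      simp
    have h6 : ‖V g‖ ^ 2 = 1 - 2 * 1 + ‖d‖ ^ 2 * ‖g‖ ^ 2 := by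
      rw [h4, @norm_sub_sq ℂ, h5, norm_vac, norm_smul, mul_pow]
      simp
    have h7 : ‖g‖ ^ 2 = 1 := by linear_combination h2 - h6
    rwa [pow_eq_one_iff_of_nonneg (norm_nonneg g) two_ne_zero] at h7
  have hTg' : ∀ j, ContinuousLinearMap.adjoint (T j) g = 0 := by
    have h1 := congrArg (fun x => ⟪g, x⟫_ℂ) (hdef g)
    have e : ∀ j, ⟪g, T j (ContinuousLinearMap.adjoint (T j) g)⟫_ℂ =
        (‖ContinuousLinearMap.adjoint (T j) g‖ : ℂ) ^ 2 := fun j => by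
      rw [← ContinuousLinearMap.adjoint_inner_left, norm_sq_eq_inner]
    simp only [inner_sum, e, ← norm_sq_eq_inner, hgn, Complex.ofReal_one, one_pow, one_smul,
      sub_self, inner_zero_right] at h1
    have h2 : ∑ j, ‖ContinuousLinearMap.adjoint (T j) g‖ ^ 2 = 0 := by exact_mod_cast h1
    intro j
    have := (Finset.sum_eq_zero_iff_of_nonneg fun i _ => sq_nonneg _).1 h2 j (Finset.mem_univ j)
    simpa using this
  have hTg : ∀ j x, ⟪g, T j x⟫_ℂ = 0 := fun j x => by
    rw [← ContinuousLinearMap.adjoint_inner_left, hTg', inner_zero_left]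
  -- The range of T_j is orthogonal to g, so T T^* is the identity on it. The row T is injective
  -- because the row (L_1, …, L_n) is; cancelling T gives T^* T = 1.
  have hTT : ∀ i j x, ContinuousLinearMap.adjoint (T i) (T j x) = if i = j then x else 0 := by
    intro i j x
    have h1 := hdef (T j x)
    rw [hTg, zero_smul, sub_zero] at h1
    have h2 : ∑ i, T i (ContinuousLinearMap.adjoint (T i) (T j x) - if i = j then x else 0) = 0 := by
      have e : ∀ i, T i (if i = j then x else 0) = if i = j then T i x else 0 := fun i => by
        split_ifs <;> simp
      simp only [map_sub, e, Finset.sum_sub_distrib, h1]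
      simp
    have h3 : ∑ i, linOp (M (Sum.inl i))
        (ContinuousLinearMap.adjoint (T i) (T j x) - if i = j then x else 0) = 0 := by
      have := congrArg L₀ h2
      rw [map_sum, map_zero] at this
      exact (Finset.sum_congr rfl fun i _ => DFunLike.congr_fun (hLT i).symm _).trans this
    exact sub_eq_zero.1 (hM.eq_zero_of_sum_linOp_eq_zero h3 i)
  have hin : ∀ i j x y, ⟪T i x, T j y⟫_ℂ = if i = j then ⟪x, y⟫_ℂ else 0 := by
    intro i j x y
    rw [← ContinuousLinearMap.adjoint_inner_right, hTT]
    split_ifs <;> simp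
  obtain ⟨U, hUv, hUT⟩ := exists_linearIsometry hgn hin hTg
  -- surjectivity
  set W : Submodule ℂ (Fock n) := LinearMap.range U.toLinearMap with hW
  have hWc : IsClosed (W : Set (Fock n)) := by
    have : (W : Set (Fock n)) = Set.range U := rfl
    rw [this]
    exact U.isometry.isClosedEmbedding.isClosed_range
  -- N = M⁻¹ expresses S_j and 1 as L₀ times combinations of the T_a and 1. As W is invariant under
  -- the T_a, it is invariant under the S_j once it is so under L₀.
  set N := formMatrix n * Mᴴ * formMatrix n with hN
  set T' : Fin n ⊕ Unit → Fock n →L[ℂ] Fock n := Sum.elim T fun _ => 1 with hT'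
  have hT'W : ∀ p, T' p ∈ invariantOps W := by
    rintro (j | _)
    · rintro _ ⟨x, rfl⟩
      exact ⟨creation j x, hUT j x⟩
    · exact one_mem _
  have hLT' : ∀ p, L₀ * T' p = linOp (M p) := by
    rintro (j | _)
    · exact hLT j
    · exact mul_one _
  have hgen : ∀ p, L₀ * ∑ a, N p a • T' a = gen p := fun p => by
    rw [Finset.mul_sum, ← sum_smul_linOp N M hM.left_inv p]
    exact Finset.sum_congr rfl fun a _ => by rw [mul_smul_comm, hLT']
  have hmem : ∀ p, ∑ a, N p a • T' a ∈ invariantOps W := fun p =>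
    sum_mem fun a _ => Subalgebra.smul_mem _ (hT'W a) _
  have hL₀W : L₀ ∈ invariantOps W := by
    -- L₀ is the inverse of Q. Since T is a row isometry and N preserves the form, the constant term
    -- of Q dominates again, and the Neumann series shows that L₀ leaves W invariant.
    set Q := ∑ a, N (Sum.inr ()) a • T' a with hQ
    have hLQ : L₀ * Q = 1 := hgen (Sum.inr ())
    have hNrow := hM.inv.sum_norm_sq_row
    rw [← hN] at hNrow
    have hb : ‖Q - N (Sum.inr ()) (Sum.inr ()) • 1‖ < ‖N (Sum.inr ()) (Sum.inr ())‖ := by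
      have hQ' : Q - N (Sum.inr ()) (Sum.inr ()) • 1 =
          ∑ j, N (Sum.inr ()) (Sum.inl j) • T j := by
        rw [hQ, sum_homog]
        exact add_sub_cancel_right _ _
      have h0 : 0 ≤ ∑ j, ‖N (Sum.inr ()) (Sum.inl j)‖ ^ 2 :=
        Finset.sum_nonneg fun _ _ => sq_nonneg _
      rw [hQ']
      refine lt_of_le_of_lt (ContinuousLinearMap.opNorm_le_bound _
        (Real.sqrt_nonneg (∑ j, ‖N (Sum.inr ()) (Sum.inl j)‖ ^ 2)) fun x => ?_)
        ((Real.sqrt_lt' ?_).2 (by linarith))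
      · refine le_of_sq_le_sq (le_of_eq ?_) (by positivity)
        rw [mul_pow, Real.sq_sqrt h0]
        have e : (∑ j, N (Sum.inr ()) (Sum.inl j) • T j) x =
            ∑ j, N (Sum.inr ()) (Sum.inl j) • T j x := by simp
        rw [e]
        have : ((‖∑ j, N (Sum.inr ()) (Sum.inl j) • T j x‖ ^ 2 : ℝ) : ℂ) =
            (((∑ j, ‖N (Sum.inr ()) (Sum.inl j)‖ ^ 2) * ‖x‖ ^ 2 : ℝ) : ℂ) := by
          push_cast
          rw [norm_sq_eq_inner, norm_sq_eq_inner, sum_inner, Finset.sum_mul]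
          refine Finset.sum_congr rfl fun i _ => ?_
          rw [inner_sum, Finset.sum_eq_single i]
          · rw [inner_smul_left, inner_smul_right, hin, if_pos rfl, ← mul_assoc,
              Complex.conj_mul']
          · intro k _ hk
            rw [inner_smul_left, inner_smul_right, hin, if_neg hk.symm, mul_zero, mul_zero]
          · simp
        exact_mod_cast this
      · refine norm_pos_iff.2 fun h1 => ?_
        rw [h1, norm_zero, zero_pow two_ne_zero] at hNrow
        linarith
    obtain ⟨R', hR', hR'Q, hQR'⟩ := exists_inverse_mem (invariantOps W)
      (isClosed_invariantOps hWc) (hmem (Sum.inr ())) (by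
        rintro h
        rw [h, norm_zero] at hb
        exact absurd hb (norm_nonneg _).not_gt) hb
    rwa [left_inv_eq_right_inv hLQ hQR']
  have hgenW : ∀ p, gen p ∈ invariantOps W := fun p => by
    rw [← hgen p]
    exact mul_mem hL₀W (hmem p)
  have hvacW : vac n ∈ W := by
    rw [← hLR' (vac n), ← hg]
    exact hL₀W g ⟨vac n, hUv⟩
  have hWtop : W = ⊤ := by
    refine eq_top_of_basisVec_mem hWc fun w => ?_
    induction w with
    | nil => exact hvacW
    | cons j w ih =>
      rw [← creation_basisVec]
      exact hgenW (Sum.inl j) _ ih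
  exact ⟨LinearIsometryEquiv.ofSurjective U (LinearMap.range_eq_top.1 hWtop), T,
    fun j => mul_mem hR (linOp_mem_hardyOps _), hLT, hUT⟩

/-! ### Unitarily implemented endomorphisms of the noncommutative Hardy algebra -/

/-- Conjugation by a unitary operator. -/
def conjUnitary (U : Fock n ≃ₗᵢ[ℂ] Fock n) :
    (Fock n →WOT[ℂ] Fock n) →ₐ[ℂ] (Fock n →WOT[ℂ] Fock n) :=
  ((ContinuousLinearMapWOT.algEquiv ℂ).trans
    (U.toContinuousLinearEquiv.conjContinuousAlgEquiv.toAlgEquiv.trans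
      (ContinuousLinearMapWOT.algEquiv ℂ).symm)).toAlgHom

theorem conjUnitary_apply (U : Fock n ≃ₗᵢ[ℂ] Fock n) (A : Fock n →WOT[ℂ] Fock n) (x : Fock n) :
    conjUnitary U A x = U (A (U.symm x)) := rfl

theorem continuous_conjUnitary (U : Fock n ≃ₗᵢ[ℂ] Fock n) : Continuous (conjUnitary U) := by
  refine ContinuousLinearMapWOT.continuous_of_dual_apply_continuous fun x y => ?_
  exact ContinuousLinearMapWOT.continuous_dual_apply (U.symm x)
    (y.comp U.toContinuousLinearEquiv.toContinuousLinearMap)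

theorem conjUnitary_mem (U : Fock n ≃ₗᵢ[ℂ] Fock n)
    (hU : ∀ j, conjUnitary U (ContinuousLinearMapWOT.ofCLM (creation j)) ∈ hardyAlg n)
    {A : Fock n →WOT[ℂ] Fock n} (hA : A ∈ hardyAlg n) : conjUnitary U A ∈ hardyAlg n := by
  have h : hardyAlg n ≤ (hardyAlg n).comap (conjUnitary U) := by
    refine Subalgebra.topologicalClosure_minimal (Algebra.adjoin_le ?_)
      ((Subalgebra.isClosed_topologicalClosure _).preimage (continuous_conjUnitary U))
    rintro _ ⟨j, rfl⟩
    exact hU j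
  exact h hA

/-- The endomorphism of the noncommutative Hardy algebra that a unitary operator implements. -/
def endo (U : Fock n ≃ₗᵢ[ℂ] Fock n)
    (hU : ∀ j, conjUnitary U (ContinuousLinearMapWOT.ofCLM (creation j)) ∈ hardyAlg n) :
    FInf n →ₐ[ℂ] FInf n :=
  ((conjUnitary U).comp (hardyAlg n).val).codRestrict (hardyAlg n)
    fun φ => conjUnitary_mem U hU φ.2

variable {U : Fock n ≃ₗᵢ[ℂ] Fock n}
  {hU : ∀ j, conjUnitary U (ContinuousLinearMapWOT.ofCLM (creation j)) ∈ hardyAlg n}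

theorem continuous_endo : Continuous (endo U hU) :=
  ((continuous_conjUnitary U).comp continuous_subtype_val).subtype_mk _

/-- U acting entrywise is unitary on (F²)^k and conjugates one matrix operator into the other. -/
theorem norm_matOp_endo_le {k : ℕ} (A : Matrix (Fin k) (Fin k) (FInf n)) :
    ‖matOp (A.map (endo U hU))‖ ≤ ‖matOp A‖ := by
  refine ContinuousLinearMap.opNorm_le_bound _ (norm_nonneg _) fun x => ?_
  set y : PiLp 2 fun _ : Fin k => Fock n := WithLp.toLp 2 fun j => U.symm (x j) with hy
  have h1 : ‖matOp (A.map (endo U hU)) x‖ = ‖matOp A y‖ := by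
    rw [PiLp.norm_eq_of_L2, PiLp.norm_eq_of_L2]
    congr 1
    refine Finset.sum_congr rfl fun i _ => ?_
    rw [matOp_apply, matOp_apply, ← U.norm_map (∑ j, toOp (A i j) (y j)), map_sum]
    rfl
  have h2 : ‖y‖ = ‖x‖ := by
    rw [PiLp.norm_eq_of_L2, PiLp.norm_eq_of_L2]
    simp [hy]
  rw [h1, ← h2]
  exact (matOp A).le_opNorm y

theorem toOp_injective : Function.Injective (toOp : FInf n → _) := fun _ _ h =>
  Subtype.ext (ContinuousLinearMapWOT.toCLM_injective h)

/-- The element `∑ c_j S_j + c_0` of the noncommutative Hardy algebra. -/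
def linElt (c : Fin n ⊕ Unit → ℂ) : FInf n := row (fun j => c (Sum.inl j)) + c (Sum.inr ()) • 1

theorem toOp_linElt (c : Fin n ⊕ Unit → ℂ) : toOp (linElt c) = linOp c := by
  have : toOp (linElt c) = toOp (row fun j => c (Sum.inl j)) + c (Sum.inr ()) • 1 := rfl
  rw [this, toOp_row, linOp_eq]

theorem eval_linElt (z : Ball n) (c : Fin n ⊕ Unit → ℂ) : eval z (linElt c) = c ⬝ᵥ homog z := by
  simp [linElt, row, eval_S, dotProduct, homog]

/-- Every transformation of the ball that preserves the form is implemented by an endomorphism of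
the noncommutative Hardy algebra. -/
theorem PreservesForm.exists_endo {M : Matrix (Fin n ⊕ Unit) (Fin n ⊕ Unit) ℂ}
    (hM : PreservesForm M) {γ : Ball n → Ball n} (hγ : Moves M γ) :
    ∃ θ : FInf n →ₐ[ℂ] FInf n, Continuous θ ∧
      (∀ (k : ℕ) (A : Matrix (Fin k) (Fin k) (FInf n)), ‖matOp (A.map θ)‖ ≤ ‖matOp A‖) ∧
      ∀ z φ, eval z (θ φ) = eval (γ z) φ := by
  obtain ⟨U, T, hT, hLT, hUT⟩ := hM.exists_unitary
  have hconj : ∀ j, conjUnitary U (ContinuousLinearMapWOT.ofCLM (creation j)) =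
      ContinuousLinearMapWOT.ofCLM (T j) := fun j => by
    refine ContinuousLinearMapWOT.ext fun x => ?_
    rw [conjUnitary_apply]
    change U (creation j (U.symm x)) = T j x
    rw [hUT, U.apply_symm_apply]
  have hU : ∀ j, conjUnitary U (ContinuousLinearMapWOT.ofCLM (creation j)) ∈ hardyAlg n :=
    fun j => by rw [hconj]; exact hT j
  refine ⟨endo U hU, continuous_endo, fun k A => norm_matOp_endo_le A, fun z φ => ?_⟩
  -- Both sides are weak* continuous characters, so only the S_j matter; there the relation L₀ T_j =
  -- L_j evaluates to the fractional linear formula for γ.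
  have key : (eval z).comp (endo U hU) = eval (γ z) := by
    refine eval_unique _ _ ((continuous_eval z).comp (continuous_endo (hU := hU))) fun j => ?_
    have h1 : linElt (M (Sum.inr ())) * endo U hU (S j) = linElt (M (Sum.inl j)) := by
      apply toOp_injective
      rw [toOp_linElt, ← hLT j, ← toOp_linElt]
      change _ * toOp (endo U hU (S j)) = _
      congr 1
      exact congrArg ContinuousLinearMapWOT.toCLM (hconj j)
    have h2 := congrArg (eval z) h1
    rw [map_mul, eval_linElt, eval_linElt] at h2
    obtain ⟨c, hc, h⟩ := hγ z
    have h3 : M (Sum.inr ()) ⬝ᵥ homog z = c := (congrFun h (Sum.inr ())).trans (mul_one c)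
    have h4 : M (Sum.inl j) ⬝ᵥ homog z = c * (γ z).1 j := congrFun h (Sum.inl j)
    rw [h3, h4] at h2
    exact mul_left_cancel₀ hc h2
  exact DFunLike.congr_fun key φ

/-! ### Automorphisms of the quotient -/

variable {Δ : Set (Ball n)}

theorem mem_nevanlinna_of_specClosure {φ : FInf n} (h : ∀ z ∈ specClosure Δ, eval z φ = 0) :
    φ ∈ nevanlinna Δ := fun z hz => h z (subset_specClosure hz)

theorem continuous_weakStar_rng {X : Type*} [TopologicalSpace X] {g : X → QuotAlg Δ}
    (h : ∀ f : QuotAlg Δ →ₗ[ℂ] ℂ, Continuous (fun φ : FInf n => f (proj Δ φ)) →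
      Continuous fun x => f (g x)) : @Continuous _ _ _ (weakStar Δ) g :=
  continuous_iInf_rng.2 fun f => continuous_induced_rng.2 (h f.1 f.2)

/-- If f lies in the predual of the quotient, so does f ∘ q, because its pullback is that of f
composed with θ. -/
theorem continuous_weakStar_of_semiconj {q : QuotAlg Δ →ₗ[ℂ] QuotAlg Δ} {θ : FInf n → FInf n}
    (hθ : Continuous θ) (hq : ∀ φ, q (proj Δ φ) = proj Δ (θ φ)) :
    @Continuous _ _ (weakStar Δ) (weakStar Δ) q := by
  refine @continuous_weakStar_rng _ _ _ (weakStar Δ) _ fun f hf => ?_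
  have h1 : Continuous fun φ => (f.comp q) (proj Δ φ) := by
    have : (fun φ => f.comp q (proj Δ φ)) = fun φ => f (proj Δ (θ φ)) :=
      funext fun φ => congrArg f (hq φ)
    rw [this]
    exact hf.comp hθ
  have h2 := continuous_weakStar_of_comp_proj h1
  exact h2

/-- A transformation of the ball that preserves the form and maps the spectral closure into itself
acts on the quotient algebra. -/
theorem PreservesForm.exists_quotient_endo {M : Matrix (Fin n ⊕ Unit) (Fin n ⊕ Unit) ℂ}
    (hM : PreservesForm M) {γ : Ball n → Ball n} (hγ : Moves M γ)
    (hV : ∀ z ∈ specClosure Δ, γ z ∈ specClosure Δ) :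
    ∃ q : QuotAlg Δ →ₐ[ℂ] QuotAlg Δ, @Continuous _ _ (weakStar Δ) (weakStar Δ) q ∧
      (∀ (k : ℕ) (B : Matrix (Fin k) (Fin k) (QuotAlg Δ)),
        quotMatNorm Δ (B.map q) ≤ quotMatNorm Δ B) ∧
      ∀ (z : specClosure Δ) a, quotEval Δ z (q a) = quotEval Δ ⟨γ z.1, hV z.1 z.2⟩ a := by
  obtain ⟨θ, hθ, hnorm, heval⟩ := hM.exists_endo hγ
  -- Well defined: an element of the ideal vanishes on the whole spectral closure, in particular at
  -- γ z.
  let q : QuotAlg Δ →ₐ[ℂ] QuotAlg Δ := Ideal.Quotient.liftₐ (nevanlinna Δ) ((proj Δ).comp θ)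
    (fun φ hφ => Ideal.Quotient.eq_zero_iff_mem.2
      (mem_nevanlinna_of_specClosure fun z hz => (heval z φ).trans (hV z hz φ hφ)))
  have hq : ∀ φ, q (proj Δ φ) = proj Δ (θ φ) := fun φ => rfl
  refine ⟨q, continuous_weakStar_of_semiconj (q := q.toLinearMap) hθ hq, fun k B => ?_,
    fun z a => ?_⟩
  · refine le_of_forall_gt_imp_ge_of_dense fun r hr => ?_
    obtain ⟨A, rfl, hA⟩ := exists_lift_of_quotMatNorm_lt hr
    have : (A.map (proj Δ)).map q = (A.map θ).map (proj Δ) := rfl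
    rw [this]
    exact (quotMatNorm_le _).trans ((hnorm k A).trans hA.le)
  · obtain ⟨φ, rfl⟩ := proj_surjective a
    rw [hq, quotEval_proj, heval]
    rfl

theorem exists_autGroup {γ : Equiv.Perm (Ball n)} (hγ : γ ∈ stabGroup Δ) :
    ∃ Φ : autGroup Δ, ∀ z : specClosure Δ, (dualPt Φ z).1 = γ z.1 := by
  obtain ⟨⟨M, hM, hMγ⟩, hV⟩ := hγ
  obtain ⟨⟨N, hN, hNγ⟩, hV'⟩ := (stabGroup Δ).inv_mem ⟨⟨M, hM, hMγ⟩, hV⟩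
  have hmem : ∀ z ∈ specClosure Δ, γ z ∈ specClosure Δ := fun z hz =>
    hV ▸ Set.mem_image_of_mem γ hz
  have hmem' : ∀ z ∈ specClosure Δ, γ⁻¹ z ∈ specClosure Δ := fun z hz =>
    hV' ▸ Set.mem_image_of_mem (γ⁻¹ : Equiv.Perm (Ball n)) hz
  obtain ⟨q, hqc, hqn, hq⟩ := PreservesForm.exists_quotient_endo (M := M.1) hM hMγ.moves hmem
  obtain ⟨p, hpc, hpn, hp⟩ := PreservesForm.exists_quotient_endo (M := N.1) hN hNγ.moves hmem'
  have hqp : ∀ a, q (p a) = a := fun a => QuotAlg.ext_quotEval fun z => by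
    rw [hq, hp]
    congr 2
    exact Subtype.ext (γ.symm_apply_apply z.1)
  have hpq : ∀ a, p (q a) = a := fun a => QuotAlg.ext_quotEval fun z => by
    rw [hp, hq]
    congr 2
    exact Subtype.ext (γ.apply_symm_apply z.1)
  -- The dual map is built from Φ⁻¹, so Φ is composition with γ⁻¹ and its inverse is composition
  -- with γ.
  let Φ : QuotAlg Δ ≃ₐ[ℂ] QuotAlg Δ :=
    AlgEquiv.ofAlgHom p q (AlgHom.ext hpq) (AlgHom.ext hqp)
  have hΦ : Φ ∈ autGroup Δ := by
    refine ⟨hpc, hqc, fun k B => le_antisymm (hpn k B) ?_⟩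
    have h1 := hqn k (B.map p)
    have h2 : (B.map p).map q = B := by
      ext i j
      exact hqp (B i j)
    rw [h2] at h1
    exact h1
  refine ⟨⟨Φ, hΦ⟩, fun z => ?_⟩
  have : dualPt ⟨Φ, hΦ⟩ z = ⟨γ z.1, hmem z.1 z.2⟩ := by
    refine specClosure_ext fun a => ?_
    rw [← quotEval_symm]
    exact hq z a
  rw [this]

/-! ### The isomorphism -/

theorem isBiholo_of_mem_stabGroup {γ : Equiv.Perm (Ball n)} (hγ : γ ∈ stabGroup Δ) :
    IsBiholo γ := by
  obtain ⟨⟨M, -, hMγ⟩, -⟩ := hγ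
  exact ⟨hMγ.moves.isHolo, hMγ.inv.moves.isHolo⟩

theorem IsBiholo.eq_of_eqOn {V : Set (Ball n)}
    (hV : affineSpan ℂ ((fun z : Ball n => (z : Cn n)) '' V) = ⊤) {γ δ : Equiv.Perm (Ball n)}
    (hγ : IsBiholo γ) (hδ : IsBiholo δ) (h : ∀ z ∈ V, γ z = δ z) : γ = δ := by
  have h1 : γ⁻¹ * δ = 1 := (hγ.inv.mul hδ).eq_one hV fun z hz => by
    rw [Equiv.Perm.mul_apply, ← h z hz]
    exact γ.symm_apply_apply z
  exact inv_mul_eq_one.1 h1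

theorem exists_stabGroup (i₀ : Fin n)
    (hspan : affineSpan ℂ ((fun z : Ball n => (z : Cn n)) '' specClosure Δ) = ⊤)
    (Φ : autGroup Δ) :
    ∃ γ : stabGroup Δ, ∀ z : specClosure Δ, γ.1 z.1 = (dualPt Φ z).1 := by
  obtain ⟨M, hM, hMΦ⟩ := exists_preservesForm_dualPt i₀ hspan Φ
  obtain ⟨γ, hγ, -⟩ := hM.exists_perm
  have hγΦ : ∀ z : specClosure Δ, γ z.1 = (dualPt Φ z).1 := fun z => by
    obtain ⟨c, hc, h⟩ := hMΦ z
    obtain ⟨d, hd, h'⟩ := hγ z.1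
    exact homog_smul_injective hd (h'.symm.trans h)
  refine ⟨⟨γ, hM.exists_SUn1 hγ, ?_⟩, hγΦ⟩
  refine Set.Subset.antisymm ?_ fun z hz => ?_
  · rintro _ ⟨z, hz, rfl⟩
    rw [hγΦ ⟨z, hz⟩]
    exact (dualPt Φ ⟨z, hz⟩).2
  · refine ⟨(dualPt Φ⁻¹ ⟨z, hz⟩).1, (dualPt Φ⁻¹ ⟨z, hz⟩).2, ?_⟩
    rw [hγΦ, dualPt_dualPt_inv]

end NCHardy

end

theorem mainTheorem2 (n : ℕ) (hn : 0 < n) (Δ : Set (NCHardy.Ball n))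
    (hspan : affineSpan ℂ ((fun z : NCHardy.Ball n => (z : NCHardy.Cn n)) ''
      NCHardy.specClosure Δ) = ⊤) :
    ∃ Θ : NCHardy.autGroup Δ ≃* NCHardy.stabGroup Δ, ∀ Φ : NCHardy.autGroup Δ,
      NCHardy.IsBiholo (Θ Φ).1 ∧
      (∀ z : NCHardy.specClosure Δ,
        (((Θ Φ).1 z.1 : NCHardy.Ball n) : NCHardy.Cn n) = NCHardy.dualMap Δ Φ z) ∧
      ∀ γ : Equiv.Perm (NCHardy.Ball n), NCHardy.IsBiholo γ →
        (∀ z : NCHardy.specClosure Δ,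
          ((γ z.1 : NCHardy.Ball n) : NCHardy.Cn n) = NCHardy.dualMap Δ Φ z) →
        γ = (Θ Φ).1 := by
  choose f hf using NCHardy.exists_stabGroup ⟨0, hn⟩ hspan
  have huniq : ∀ (Φ : NCHardy.autGroup Δ) (γ : Equiv.Perm (NCHardy.Ball n)), NCHardy.IsBiholo γ →
      (∀ z : NCHardy.specClosure Δ, γ z.1 = (NCHardy.dualPt Φ z).1) → γ = (f Φ).1 :=
    fun Φ γ hγ h => hγ.eq_of_eqOn hspan (NCHardy.isBiholo_of_mem_stabGroup (f Φ).2)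
      fun z hz => (h ⟨z, hz⟩).trans (hf Φ ⟨z, hz⟩).symm
  -- Both f (Φ Ψ) and f Φ f Ψ extend the dual map of Φ Ψ, so uniqueness of the extension gives
  -- multiplicativity.
  let F : NCHardy.autGroup Δ →* NCHardy.stabGroup Δ := MonoidHom.mk' f fun Φ Ψ => by
    refine (Subtype.ext (huniq _ _ (NCHardy.isBiholo_of_mem_stabGroup (f Φ * f Ψ).2)
      fun z => ?_)).symm
    change (f Φ).1 ((f Ψ).1 z.1) = _
    rw [hf, hf, NCHardy.dualPt_mul]
  have hF : Function.Bijective F := by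
    refine ⟨fun Φ Ψ h => NCHardy.dualPt_injective (funext fun z => Subtype.ext ?_), fun γ => ?_⟩
    · rw [← hf, ← hf]
      exact congrArg (fun γ : NCHardy.stabGroup Δ => γ.1 z.1) h
    · obtain ⟨Φ, hΦ⟩ := NCHardy.exists_autGroup γ.2
      exact ⟨Φ, (Subtype.ext (huniq Φ γ.1 (NCHardy.isBiholo_of_mem_stabGroup γ.2)
        fun z => (hΦ z).symm)).symm⟩
  refine ⟨MulEquiv.ofBijective F hF, fun Φ =>
    ⟨NCHardy.isBiholo_of_mem_stabGroup (f Φ).2, fun z => ?_, fun γ hγ h => ?_⟩⟩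
  · rw [NCHardy.dualMap_eq]
    exact congrArg Subtype.val (hf Φ z)
  · exact huniq Φ γ hγ fun z => Subtype.ext ((h z).trans (NCHardy.dualMap_eq Φ z))
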